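/- Let $(M,g)$ be a smooth finite-dimensional Riemannian manifold without boundary, with Levi-Civita connection $\nabla$ and curvature $R(X,Y)=[\nabla_X,\nabla_Y]-\nabla_{[X,Y]}$. Let $\pi:TM\to M$ be the projection and $K:TTM\to TM$ the connection map of $\nabla$ (so that $K(d\sigma(X))=\nabla_X\sigma$ for all vector fields $\sigma, X$), and put $\omega(e)=(1+|e|^2)^{-1}$ for $e\in TM$. For $p,q\in\mathbb R$ with $q\ge 0$, let $h_{p,q}$ be the Riemannian metric on $TM$ given by $$h_{p,q}(A,B)=g(d\pi(A),d\pi(B))+\omega(e)^p\big[g(KA,KB)+q\,g(KA,e)\,g(KB,e)\big],\qquad A,B\in T_eTM .$$ A smooth map $\varphi$ between Riemannian manifolds is harmonic if its tension field $\tau(\varphi)=\operatorname{trace}\nabla d\varphi$ vanishes identically. For a vector field $\sigma$, put $\nabla^*\nabla\sigma=-\operatorname{trace}\nabla^2\sigma$, let $X(\sigma)$ be the gradient of $\tfrac12|\sigma|^2$, and let $|\nabla\sigma|^2=\sum_i|\nabla_{e_i}\sigma|^2$. Then a smooth vector field $\sigma$ on $M$ is a harmonic map $(M,g)\to(TM,h_{p,q})$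 if and only if both of the following hold everywhere on $M$: $$\sum_i R(\sigma,\nabla_{e_i}\sigma)e_i=0,$$ $$\nabla^*\nabla\sigma+2p\,\omega(\sigma)\nabla_{X(\sigma)}\sigma=\Big[\frac{p\,\omega(\sigma)+q}{1+q|\sigma|^2}\,|\nabla\sigma|^2+\frac{p\,q\,\omega(\sigma)}{1+q|\sigma|^2}\,|X(\sigma)|^2\Big]\sigma,$$ where $\{e_i\}$ is an orthonormal frame on $(M,g)$. -/

import Mathlib

open Bundle
open scoped Manifold ContDiff

noncomputable section

namespace GenCheegerGromoll

/-! ### Riemannian calculus in a coordinate domain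

Here `g : E → E → ℝ` is an inner product on the finite-dimensional space `E` (which need not be
related to the norm of `E`), and `G : E → E → E → ℝ` is the matrix `(g_ij)` of a metric as a
function of the coordinates: `G u a b` is the inner product at the point with coordinates `u` of the
vectors with components `a` and `b`. The basis `Module.finBasis ℝ E` is an auxiliary choice that the
quantities below do not depend on. -/

section Coordinates

variable {E : Type*} [NormedAddCommGroup E] [NormedSpace ℝ E] [FiniteDimensional ℝ E]

/-- The matrix `(g^{ij})`, inverse to `(g_ij) = (g(b_i, b_j))`. -/
def invGram (g : E → E → ℝ) :
    Matrix (Fin (Module.finrank ℝ E)) (Fin (Module.finrank ℝ E)) ℝ :=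
  (Matrix.of fun i j ↦ g (Module.finBasis ℝ E i) (Module.finBasis ℝ E j))⁻¹

/-- The trace `∑ g^{ij} B(b_i, b_j)` of a bilinear map `B`. -/
def metricTrace {F : Type*} [AddCommGroup F] [Module ℝ F] (g : E → E → ℝ) (B : E → E → F) : F :=
  ∑ i, ∑ j, invGram g i j • B (Module.finBasis ℝ E i) (Module.finBasis ℝ E j)

/-- The vector `α^♯ = ∑ g^{ij} α(b_i) b_j` with `g(α^♯, c) = α(c)` for all `c`, where `α` is a
linear form. -/
def sharp (g : E → E → ℝ) (α : E → ℝ) : E :=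
  ∑ i, ∑ j, (invGram g i j * α (Module.finBasis ℝ E i)) • Module.finBasis ℝ E j

/-- The Christoffel symbols `Γ(a, b)` of the Levi-Civita connection:
`G(Γ(a, b), c) = ½ (∂_a G(b, c) + ∂_b G(a, c) - ∂_c G(a, b))`. -/
def christoffel (G : E → E → E → ℝ) (u a b : E) : E :=
  sharp (G u) fun c ↦ 1 / 2 *
    (fderiv ℝ (fun w ↦ G w b c) u a + fderiv ℝ (fun w ↦ G w a c) u b
      - fderiv ℝ (fun w ↦ G w a b) u c)

/-- `∇_a s` for a vector field `s` in coordinates. -/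
def localCovDeriv (G : E → E → E → ℝ) (s : E → E) (u a : E) : E :=
  fderiv ℝ s u a + christoffel G u a (s u)

/-- `∇²_{a,b} s = ∇_a ∇_b s - ∇_{∇_a b} s`, where on the right-hand side `a`, `b` are extended to
vector fields with constant coefficients. -/
def localSecondCovDeriv (G : E → E → E → ℝ) (s : E → E) (u a b : E) : E :=
  localCovDeriv G (fun w ↦ localCovDeriv G s w b) u a -
    localCovDeriv G s u (localCovDeriv G (fun _ ↦ b) u a)

/-- `R(a, b) c = ∇_a ∇_b c - ∇_b ∇_a c - ∇_{[a,b]} c`, where `a`, `b`, `c` are extended to vector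
fields with constant coefficients, so that `[a, b] = 0`. -/
def localCurvature (G : E → E → E → ℝ) (u a b c : E) : E :=
  localCovDeriv G (fun w ↦ localCovDeriv G (fun _ ↦ c) w b) u a -
    localCovDeriv G (fun w ↦ localCovDeriv G (fun _ ↦ c) w a) u b

end Coordinates

/-! ### Riemannian calculus on manifolds without boundary

In Mathlib the tangent space `TangentSpace I x` is the model vector space `E`, a tangent vector at
`x` being given by its components in the preferred chart `extChartAt I x` at `x`. All tensors at
`x` are accordingly computed in this chart. -/

section Manifolds

variable {E : Type*} [NormedAddCommGroup E] [NormedSpace ℝ E] [FiniteDimensional ℝ E]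
  {H : Type*} [TopologicalSpace H] {I : ModelWithCorners ℝ E H}
  {M : Type*} [TopologicalSpace M] [ChartedSpace H M]

/-- A family of (bilinear) forms on the tangent spaces of a manifold. -/
abbrev FormField {E : Type*} [NormedAddCommGroup E] [NormedSpace ℝ E]
    {H : Type*} [TopologicalSpace H] (I : ModelWithCorners ℝ E H)
    (M : Type*) [TopologicalSpace M] [ChartedSpace H M] :=
  ∀ x : M, TangentSpace I x → TangentSpace I x → ℝ

/-- The inner products on the tangent spaces given by a smooth Riemannian metric. -/
def toFormField [IsManifold I 1 M]
    (g : ContMDiffRiemannianMetric I ∞ E (fun x : M ↦ TangentSpace I x)) : FormField I M :=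
  fun x a b ↦ g.inner x a b

/-- The coefficients of `g` in the preferred chart at `x₀`, as a function of the coordinates:
the pull-back of `g` by the inverse of this chart. -/
def metricInChart (g : FormField I M) (x₀ : M) (u a b : E) : ℝ :=
  g ((extChartAt I x₀).symm u) (mfderiv 𝓘(ℝ, E) I (extChartAt I x₀).symm u a)
    (mfderiv 𝓘(ℝ, E) I (extChartAt I x₀).symm u b)

/-- The components of the vector field `σ` in the preferred chart at `x₀`, as a function of the
coordinates. -/
def fieldInChart (σ : ∀ x : M, TangentSpace I x) (x₀ : M) (u : E) : E :=
  mfderiv I 𝓘(ℝ, E) (extChartAt I x₀) ((extChartAt I x₀).symm u) (σ ((extChartAt I x₀).symm u))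

/-- `∇_a σ`, for the Levi-Civita connection of `g`. -/
def covDeriv (g : FormField I M) (σ : ∀ x : M, TangentSpace I x) (x : M)
    (a : TangentSpace I x) : TangentSpace I x :=
  localCovDeriv (E := E) (metricInChart g x) (fieldInChart σ x) (extChartAt I x x) a

/-- `∇²_{a,b} σ`. -/
def secondCovDeriv (g : FormField I M) (σ : ∀ x : M, TangentSpace I x) (x : M)
    (a b : TangentSpace I x) : TangentSpace I x :=
  localSecondCovDeriv (E := E) (metricInChart g x) (fieldInChart σ x) (extChartAt I x x) a b

/-- The curvature `R(a, b) c` of `g`, with `R(X, Y) = [∇_X, ∇_Y] - ∇_{[X,Y]}`. -/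
def curvature (g : FormField I M) (x : M) (a b c : TangentSpace I x) : TangentSpace I x :=
  localCurvature (E := E) (metricInChart g x) (extChartAt I x x) a b c

/-- The gradient of a function `f`. -/
def gradient (g : FormField I M) (f : M → ℝ) (x : M) : TangentSpace I x :=
  sharp (E := E) (g x) (mfderiv I 𝓘(ℝ, ℝ) f x)

/-- `|v|²` for a tangent vector `v`. -/
def normSq (g : FormField I M) {x : M} (v : TangentSpace I x) : ℝ := g x v v

/-- `X(σ)`, the gradient of `|σ|² / 2`. -/
def gradHalfNormSq (g : FormField I M) (σ : ∀ x : M, TangentSpace I x) (x : M) :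
    TangentSpace I x :=
  gradient g (fun y ↦ normSq g (σ y) / 2) x

/-- `∇*∇ σ = - trace ∇² σ`. -/
def roughLaplacian (g : FormField I M) (σ : ∀ x : M, TangentSpace I x) (x : M) :
    TangentSpace I x :=
  -metricTrace (E := E) (F := E) (g x) (secondCovDeriv g σ x)

/-- `|∇σ|²`. -/
def covDerivNormSq (g : FormField I M) (σ : ∀ x : M, TangentSpace I x) (x : M) : ℝ :=
  metricTrace (E := E) (g x) fun a b ↦ g x (covDeriv g σ x a) (covDeriv g σ x b)

/-! ### Harmonic maps -/

section HarmonicMaps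

variable {E' : Type*} [NormedAddCommGroup E'] [NormedSpace ℝ E'] [FiniteDimensional ℝ E']
  {H' : Type*} [TopologicalSpace H'] {J : ModelWithCorners ℝ E' H'}
  {N : Type*} [TopologicalSpace N] [ChartedSpace H' N]

/-- The second fundamental form `∇dφ` of a map `φ : (M, g) → (N, h)`:
`(∇dφ)(a, b) = ∂_a ∂_b φ - dφ(Γ^M(a, b)) + Γ^N(dφ a, dφ b)` in coordinates. -/
def secondFundamentalForm (g : FormField I M) (h : FormField J N) (φ : M → N) (x : M)
    (a b : TangentSpace I x) : TangentSpace J (φ x) :=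
  let φ' : E → E' := writtenInExtChartAt I J x φ
  let u : E := extChartAt I x x
  (fderiv ℝ (fun w ↦ fderiv ℝ φ' w b) u a
    - fderiv ℝ φ' u (christoffel (metricInChart g x) u a b)
    + christoffel (metricInChart h (φ x)) (extChartAt J (φ x) (φ x))
        (fderiv ℝ φ' u a) (fderiv ℝ φ' u b) : E')

/-- The tension field `τ(φ) = trace ∇dφ`. -/
def tensionField (g : FormField I M) (h : FormField J N) (φ : M → N) (x : M) :
    TangentSpace J (φ x) :=
  metricTrace (E := E) (F := E') (g x) (secondFundamentalForm g h φ x)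

/-- A smooth map is harmonic if its tension field vanishes. -/
def IsHarmonicMap (g : FormField I M) (h : FormField J N) (φ : M → N) : Prop :=
  ContMDiff I J ∞ φ ∧ ∀ x, tensionField g h φ x = 0

end HarmonicMaps

/-! ### The generalised Cheeger-Gromoll metrics on the tangent bundle -/

section TangentBundle

variable [IsManifold I 1 M]

/-- The connection map `K : T_e TM → T_{π(e)} M`. In the coordinates `(x, v)` of `TM` induced by
coordinates `x` on `M`, a tangent vector with components `(x', v')` at `(x, v)` is mapped to
`v' + Γ(x', v)`. -/
def connectionMap (g : FormField I M) (e : TangentBundle I M) (A : TangentSpace I.tangent e) :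
    TangentSpace I e.proj :=
  let A' : E × E := A
  (A'.2 + christoffel (E := E) (metricInChart g e.proj) (extChartAt I e.proj e.proj) A'.1 e.snd : E)

/-- `ω(v) = 1 / (1 + |v|²)`. -/
def omega (g : FormField I M) {x : M} (v : TangentSpace I x) : ℝ := (1 + normSq g v)⁻¹

/-- The metric
`h_{p,q}(A, B) = g(dπ A, dπ B) + ω(e)^p [g(K A, K B) + q g(K A, e) g(K B, e)]` on `TM`. -/
def genCheegerGromoll (g : FormField I M) (p q : ℝ) : FormField I.tangent (TangentBundle I M) :=
  fun e A B ↦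
    g e.proj (mfderiv I.tangent I (TotalSpace.proj : TangentBundle I M → M) e A)
        (mfderiv I.tangent I (TotalSpace.proj : TangentBundle I M → M) e B) +
      omega g e.snd ^ p *
        (g e.proj (connectionMap g e A) (connectionMap g e B) +
          q * g e.proj (connectionMap g e A) e.snd * g e.proj (connectionMap g e B) e.snd)

end TangentBundle

end Manifolds

end GenCheegerGromoll

end

open GenCheegerGromoll

namespace GenCheegerGromoll

set_option maxSynthPendingDepth 3

/-! ### Linear algebra of inner products -/

section InnerProducts

/-- `g` is a symmetric positive definite bilinear form. -/
structure IsInnerProduct {E : Type*} [AddCommGroup E] [Module ℝ E] (g : E → E → ℝ) : Prop where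
  add_left : ∀ a b c, g (a + b) c = g a c + g b c
  smul_left : ∀ (r : ℝ) a b, g (r • a) b = r * g a b
  symm : ∀ a b, g a b = g b a
  pos : ∀ a, a ≠ 0 → 0 < g a a

namespace IsInnerProduct

variable {E : Type*} [AddCommGroup E] [Module ℝ E] {g : E → E → ℝ}

lemma add_right (hg : IsInnerProduct g) (a b c : E) : g a (b + c) = g a b + g a c := by
  rw [hg.symm, hg.add_left, hg.symm b, hg.symm c]

lemma smul_right (hg : IsInnerProduct g) (r : ℝ) (a b : E) : g a (r • b) = r * g a b := by
  rw [hg.symm, hg.smul_left, hg.symm b]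

lemma isLinearMap_left (hg : IsInnerProduct g) (c : E) : IsLinearMap ℝ fun a ↦ g a c :=
  ⟨fun a b ↦ hg.add_left a b c, fun r a ↦ hg.smul_left r a c⟩

lemma isLinearMap_right (hg : IsInnerProduct g) (c : E) : IsLinearMap ℝ fun a ↦ g c a :=
  ⟨fun a b ↦ hg.add_right c a b, fun r a ↦ hg.smul_right r c a⟩

lemma sum_left (hg : IsInnerProduct g) {κ : Type*} (s : Finset κ) (f : κ → E) (c : E) :
    g (∑ i ∈ s, f i) c = ∑ i ∈ s, g (f i) c :=
  map_sum (hg.isLinearMap_left c).mk' f s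

lemma sum_right (hg : IsInnerProduct g) {κ : Type*} (s : Finset κ) (f : κ → E) (c : E) :
    g c (∑ i ∈ s, f i) = ∑ i ∈ s, g c (f i) :=
  map_sum (hg.isLinearMap_right c).mk' f s

lemma zero_left (hg : IsInnerProduct g) (c : E) : g 0 c = 0 :=
  (hg.isLinearMap_left c).map_zero

lemma zero_right (hg : IsInnerProduct g) (c : E) : g c 0 = 0 :=
  (hg.isLinearMap_right c).map_zero

lemma neg_left (hg : IsInnerProduct g) (a c : E) : g (-a) c = -g a c :=
  (hg.isLinearMap_left c).map_neg a

lemma sub_left (hg : IsInnerProduct g) (a b c : E) : g (a - b) c = g a c - g b c :=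
  (hg.isLinearMap_left c).map_sub a b

lemma nonneg (hg : IsInnerProduct g) (a : E) : 0 ≤ g a a := by
  rcases eq_or_ne a 0 with rfl | h
  · rw [hg.zero_left]
  · exact (hg.pos a h).le

lemma eq_zero_iff_forall (hg : IsInnerProduct g) (a : E) : a = 0 ↔ ∀ c, g a c = 0 := by
  refine ⟨fun h c ↦ by rw [h, hg.zero_left], fun h ↦ ?_⟩
  by_contra ha
  exact (hg.pos a ha).ne' (h a)

lemma eq_of_forall (hg : IsInnerProduct g) {a b : E} (h : ∀ c, g a c = g b c) : a = b := by
  rw [← sub_eq_zero, hg.eq_zero_iff_forall]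
  intro c
  rw [hg.sub_left, h, sub_self]

end IsInnerProduct

variable {E : Type*} [NormedAddCommGroup E] [NormedSpace ℝ E] [FiniteDimensional ℝ E]
  {g : E → E → ℝ}

lemma invGram_mul_gram (hg : IsInnerProduct g) :
    invGram g * (Matrix.of fun i j ↦ g (Module.finBasis ℝ E i) (Module.finBasis ℝ E j)) = 1 := by
  apply Matrix.nonsing_inv_mul
  rw [← Matrix.isUnit_iff_isUnit_det, ← Matrix.mulVec_injective_iff_isUnit]
  set b := Module.finBasis ℝ E
  have key : ∀ x : Fin (Module.finrank ℝ E) → ℝ,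
      (Matrix.of fun i j ↦ g (b i) (b j)).mulVec x = 0 → x = 0 := by
    intro x hx
    have h1 : ∀ i, g (b i) (∑ j, x j • b j) = 0 := by
      intro i
      have := congrFun hx i
      simp only [Matrix.mulVec, dotProduct, Matrix.of_apply, Pi.zero_apply] at this
      rw [hg.sum_right, ← this]
      exact Finset.sum_congr rfl fun j _ ↦ by rw [hg.smul_right, mul_comm]
    have h2 : ∑ j, x j • b j = 0 := by
      by_contra h
      refine (hg.pos _ h).ne' ?_
      conv_lhs => rw [hg.sum_left]
      exact Finset.sum_eq_zero fun i _ ↦ by rw [hg.smul_left, h1, mul_zero]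
    exact funext (Fintype.linearIndependent_iff.1 b.linearIndependent x h2)
  intro x y hxy
  rw [← sub_eq_zero]
  apply key
  rw [Matrix.mulVec_sub, sub_eq_zero]
  exact hxy

/-- The defining property of `α^♯`. -/
lemma sharp_spec (hg : IsInnerProduct g) {α : E → ℝ} (hα : IsLinearMap ℝ α) (c : E) :
    g (sharp g α) c = α c := by
  set b := Module.finBasis ℝ E
  have hb : ∀ k, g (sharp g α) (b k) = α (b k) := by
    intro k
    have h1 : ∀ i, ∑ j, invGram g i j * g (b j) (b k) = if i = k then 1 else 0 := by
      intro i
      have := congrFun (congrFun (invGram_mul_gram hg) i) k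
      rwa [Matrix.mul_apply, Matrix.one_apply] at this
    calc g (sharp g α) (b k) = ∑ i, α (b i) * ∑ j, invGram g i j * g (b j) (b k) := by
          rw [sharp, hg.sum_left]
          refine Finset.sum_congr rfl fun i _ ↦ ?_
          rw [hg.sum_left, Finset.mul_sum]
          refine Finset.sum_congr rfl fun j _ ↦ ?_
          rw [hg.smul_left]
          ring
      _ = α (b k) := by simp [h1]
  have := b.ext (f₁ := (hg.isLinearMap_right (sharp g α)).mk') (f₂ := hα.mk') hb
  exact congrArg (fun f : E →ₗ[ℝ] ℝ ↦ f c) this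

lemma _root_.IsLinearMap.map_finset_sum {V W : Type*} [AddCommGroup V] [Module ℝ V]
    [AddCommGroup W] [Module ℝ W] {f : V → W} (hf : IsLinearMap ℝ f) {κ : Type*} (s : Finset κ)
    (x : κ → V) : f (∑ i ∈ s, x i) = ∑ i ∈ s, f (x i) :=
  map_sum hf.mk' x s

/-- The trace of a bilinear map is its trace with respect to any orthonormal basis. -/
lemma metricTrace_eq_sum (hg : IsInnerProduct g) {F : Type*} [AddCommGroup F] [Module ℝ F]
    {ι : Type*} [Fintype ι] [DecidableEq ι] (e : Module.Basis ι ℝ E)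
    (he : ∀ i j, g (e i) (e j) = if i = j then 1 else 0) (B : E → E → F)
    (hB₁ : ∀ b, IsLinearMap ℝ fun a ↦ B a b) (hB₂ : ∀ a, IsLinearMap ℝ (B a)) :
    metricTrace g B = ∑ k, B (e k) (e k) := by
  set b := Module.finBasis ℝ E
  have hexp : ∀ a, a = ∑ k, g a (e k) • e k := by
    intro a
    conv_lhs => rw [← e.sum_repr a]
    refine Finset.sum_congr rfl fun k _ ↦ ?_
    congr 1
    conv_rhs => rw [← e.sum_repr a, hg.sum_left]
    simp [hg.smul_left, he]
  have hsharp : ∀ k, sharp g (fun a ↦ g a (e k)) = e k := fun k ↦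
    hg.eq_of_forall fun c ↦ by rw [sharp_spec hg (hg.isLinearMap_left _), hg.symm]
  have hB : ∀ k, B (e k) (e k) = ∑ i, ∑ j, (invGram g i j * g (b i) (e k)) • B (e k) (b j) := by
    intro k
    have : B (e k) (e k) = B (e k) (sharp g fun a ↦ g a (e k)) := by rw [hsharp k]
    rw [this, sharp, (hB₂ (e k)).map_finset_sum]
    refine Finset.sum_congr rfl fun i _ ↦ ?_
    rw [(hB₂ (e k)).map_finset_sum]
    exact Finset.sum_congr rfl fun j _ ↦ (hB₂ (e k)).map_smul _ _
  have hB' : ∀ i j, B (b i) (b j) = ∑ k, g (b i) (e k) • B (e k) (b j) := by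
    intro i j
    conv_lhs => rw [hexp (b i)]
    rw [(hB₁ (b j)).map_finset_sum]
    exact Finset.sum_congr rfl fun k _ ↦ (hB₁ (b j)).map_smul _ _
  simp only [hB]
  rw [metricTrace, Finset.sum_comm (γ := ι)]
  simp only [Finset.sum_comm (s := (Finset.univ : Finset ι))]
  refine Finset.sum_congr rfl fun i _ ↦ Finset.sum_congr rfl fun j _ ↦ ?_
  rw [hB', Finset.smul_sum]
  exact Finset.sum_congr rfl fun k _ ↦ by rw [smul_smul]

end InnerProducts

/-! ### Levi-Civita calculus for a smooth metric on an open subset of a vector space -/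

section LocalMetric

variable {E : Type*} [NormedAddCommGroup E] [NormedSpace ℝ E]

lemma _root_.HasDerivAt.clm_apply_const {V W : Type*} [NormedAddCommGroup V] [NormedSpace ℝ V]
    [NormedAddCommGroup W] [NormedSpace ℝ W] {D : ℝ → V →L[ℝ] W} {D' : V →L[ℝ] W} {t : ℝ}
    (h : HasDerivAt D D' t) (a : V) : HasDerivAt (fun r ↦ D r a) (D' a) t :=
  (ContinuousLinearMap.apply ℝ W a).hasFDerivAt.comp_hasDerivAt t h

lemma hasDerivAt_line (u d : E) (t : ℝ) : HasDerivAt (fun r : ℝ ↦ u + r • d) d t := by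
  simpa using ((hasDerivAt_id t).smul_const d).const_add u

lemma hasDerivAt_comp_line {W : Type*} [NormedAddCommGroup W] [NormedSpace ℝ W] {f : E → W}
    {u : E} (hf : DifferentiableAt ℝ f u) (d : E) :
    HasDerivAt (fun r : ℝ ↦ f (u + r • d)) (fderiv ℝ f u d) 0 := by
  have hf' : HasFDerivAt f (fderiv ℝ f u) (u + (0 : ℝ) • d) := by simpa using hf.hasFDerivAt
  exact hf'.comp_hasDerivAt (0 : ℝ) (hasDerivAt_line u d 0)

/-- `G` is a smooth Riemannian metric on the open set `U`. -/
structure IsMetricOn (G : E → E →L[ℝ] E →L[ℝ] ℝ) (U : Set E) : Prop where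
  isOpen : IsOpen U
  contDiffOn : ContDiffOn ℝ ∞ G U
  inner : ∀ u ∈ U, IsInnerProduct fun a b ↦ G u a b

/-- The operator taking the derivative of a metric to its Christoffel symbols of the first kind. -/
noncomputable def koszul : (E →L[ℝ] E →L[ℝ] E →L[ℝ] ℝ) →L[ℝ] E →L[ℝ] E →L[ℝ] E →L[ℝ] ℝ :=
  let flip₁ := (ContinuousLinearMap.flipₗᵢ ℝ E E (E →L[ℝ] ℝ)).toContinuousLinearEquiv
  let flip₂ := (ContinuousLinearMap.flipₗᵢ ℝ E E ℝ).toContinuousLinearEquiv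
  (1 / 2 : ℝ) • (ContinuousLinearMap.id ℝ _ + (flip₁ : _ →L[ℝ] _) -
    (ContinuousLinearMap.compL ℝ E (E →L[ℝ] E →L[ℝ] ℝ) (E →L[ℝ] E →L[ℝ] ℝ)
      (flip₂ : _ →L[ℝ] _)) ∘L (flip₁ : _ →L[ℝ] _))

lemma koszul_apply (D : E →L[ℝ] E →L[ℝ] E →L[ℝ] ℝ) (a b c : E) :
    koszul D a b c = 1 / 2 * (D a b c + D b a c - D c a b) := by
  simp only [koszul, smul_apply, sub_apply, add_apply, ContinuousLinearMap.coe_id', id_eq,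
    ContinuousLinearMap.coe_comp, Function.comp_apply, ContinuousLinearMap.compL_apply, smul_eq_mul]
  rfl

/-- The Christoffel symbols as a bilinear map. -/
noncomputable def christoffelL (G : E → E →L[ℝ] E →L[ℝ] ℝ) (u : E) : E →L[ℝ] E →L[ℝ] E :=
  (ContinuousLinearMap.compL ℝ E (E →L[ℝ] ℝ) E (G u).inverse) ∘L koszul (fderiv ℝ G u)

/-- The curvature tensor in terms of the Christoffel symbols. -/
noncomputable def curv (G : E → E →L[ℝ] E →L[ℝ] ℝ) (u a b c : E) : E :=
  fderiv ℝ (christoffelL G) u a b c + christoffelL G u a (christoffelL G u b c) -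
    (fderiv ℝ (christoffelL G) u b a c + christoffelL G u b (christoffelL G u a c))

variable {G : E → E →L[ℝ] E →L[ℝ] ℝ} {U : Set E} {u : E}

lemma curv_antisymm (a b c : E) : curv G u a b c = -curv G u b a c := by
  simp only [curv]; abel

namespace IsMetricOn

lemma contDiffAt (hG : IsMetricOn G U) (hu : u ∈ U) : ContDiffAt ℝ ∞ G u :=
  hG.contDiffOn.contDiffAt (hG.isOpen.mem_nhds hu)

lemma differentiableAt (hG : IsMetricOn G U) (hu : u ∈ U) : DifferentiableAt ℝ G u :=
  (hG.contDiffAt hu).differentiableAt (by simp)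

lemma symm (hG : IsMetricOn G U) (hu : u ∈ U) (a b : E) : G u a b = G u b a :=
  (hG.inner u hu).symm a b

lemma fderiv_symm (hG : IsMetricOn G U) (hu : u ∈ U) (a b c : E) :
    fderiv ℝ G u a b c = fderiv ℝ G u a c b := by
  have h (b c : E) : HasFDerivAt (fun w ↦ G w b c)
      ((ContinuousLinearMap.apply ℝ ℝ c ∘L ContinuousLinearMap.apply ℝ _ b) ∘L fderiv ℝ G u) u :=
    (ContinuousLinearMap.apply ℝ ℝ c ∘L ContinuousLinearMap.apply ℝ _ b).hasFDerivAt.comp u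
      (hG.differentiableAt hu).hasFDerivAt
  have h' : (fun w ↦ G w b c) =ᶠ[nhds u] fun w ↦ G w c b := by
    filter_upwards [hG.isOpen.mem_nhds hu] with w hw using hG.symm hw b c
  have := ((h b c).congr_of_eventuallyEq h'.symm).unique (h c b)
  exact congrArg (fun f : E →L[ℝ] ℝ ↦ f a) this

variable [FiniteDimensional ℝ E]

lemma isInvertible (hG : IsMetricOn G U) (hu : u ∈ U) : (G u).IsInvertible := by
  have hinj : Function.Injective (G u : E →ₗ[ℝ] E →L[ℝ] ℝ) := by
    rw [injective_iff_map_eq_zero]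
    intro a ha
    rw [(hG.inner u hu).eq_zero_iff_forall]
    intro c
    exact congrArg (fun f : E →L[ℝ] ℝ ↦ f c) ha
  have hdim : Module.finrank ℝ E = Module.finrank ℝ (E →L[ℝ] ℝ) := by
    rw [← (LinearMap.toContinuousLinearMap : (E →ₗ[ℝ] ℝ) ≃ₗ[ℝ] _).finrank_eq]
    exact Subspace.dual_finrank_eq.symm
  refine ⟨(LinearEquiv.ofInjectiveOfFinrankEq (G u : E →ₗ[ℝ] E →L[ℝ] ℝ) hinj
    hdim).toContinuousLinearEquiv, ?_⟩
  ext a b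
  rfl

lemma apply_christoffelL (hG : IsMetricOn G U) (hu : u ∈ U) (a b c : E) :
    G u (christoffelL G u a b) c =
      1 / 2 * (fderiv ℝ G u a b c + fderiv ℝ G u b a c - fderiv ℝ G u c a b) := by
  rw [← koszul_apply]
  simp only [christoffelL, ContinuousLinearMap.coe_comp, Function.comp_apply,
    ContinuousLinearMap.compL_apply]
  rw [(hG.isInvertible hu).self_apply_inverse]

lemma christoffelL_symm (hG : IsMetricOn G U) (hu : u ∈ U) (a b : E) :
    christoffelL G u a b = christoffelL G u b a := by
  refine (hG.inner u hu).eq_of_forall fun c ↦ ?_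
  rw [hG.apply_christoffelL hu, hG.apply_christoffelL hu, hG.fderiv_symm hu c a b]
  ring

/-- The Levi-Civita connection is compatible with the metric. -/
lemma fderiv_apply (hG : IsMetricOn G U) (hu : u ∈ U) (c a b : E) :
    fderiv ℝ G u c a b = G u (christoffelL G u c a) b + G u a (christoffelL G u c b) := by
  rw [hG.symm hu a, hG.apply_christoffelL hu, hG.apply_christoffelL hu, hG.fderiv_symm hu c b a,
    hG.fderiv_symm hu b c a]
  ring

lemma contDiffAt_christoffelL (hG : IsMetricOn G U) (hu : u ∈ U) :
    ContDiffAt ℝ ∞ (christoffelL G) u := by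
  have h1 : ContDiffAt ℝ ∞ (fun w ↦ (G w).inverse) u := by
    obtain ⟨e, he⟩ := hG.isInvertible hu
    have := contDiffAt_map_inverse (n := ∞) e
    rw [he] at this
    exact this.comp u (hG.contDiffAt hu)
  have h2 : ContDiffAt ℝ ∞ (fun w ↦ koszul (fderiv ℝ G w)) u :=
    koszul.contDiff.contDiffAt.comp u ((hG.contDiffAt hu).fderiv_right (by simp))
  exact ((ContinuousLinearMap.compL ℝ E (E →L[ℝ] ℝ) E).contDiff.contDiffAt.comp u h1).clm_comp h2

lemma differentiableAt_christoffelL (hG : IsMetricOn G U) (hu : u ∈ U) :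
    DifferentiableAt ℝ (christoffelL G) u :=
  (hG.contDiffAt_christoffelL hu).differentiableAt (by simp)

/-- The product rule for the inner product of two vector fields along a curve. -/
lemma hasDerivAt_inner (hG : IsMetricOn G U) {γ X Y : ℝ → E} {c x y : E} {t : ℝ} (hu : γ t ∈ U)
    (hγ : HasDerivAt γ c t) (hX : HasDerivAt X x t) (hY : HasDerivAt Y y t) :
    HasDerivAt (fun r ↦ G (γ r) (X r) (Y r))
      (G (γ t) (x + christoffelL G (γ t) c (X t)) (Y t) +
        G (γ t) (X t) (y + christoffelL G (γ t) c (Y t))) t := by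
  have h := (((hG.differentiableAt hu).hasFDerivAt.comp_hasDerivAt t hγ).clm_apply hX).clm_apply hY
  convert! h using 1
  simp only [map_add, add_apply, Function.comp_apply, hG.fderiv_apply hu]
  ring

lemma christoffel_eq (hG : IsMetricOn G U) (hu : u ∈ U) (a b : E) :
    christoffel (fun w a b ↦ G w a b) u a b = christoffelL G u a b := by
  have h (b c : E) : fderiv ℝ (fun w ↦ G w b c) u =
      (ContinuousLinearMap.apply ℝ ℝ c ∘L ContinuousLinearMap.apply ℝ _ b) ∘L fderiv ℝ G u :=
    ((ContinuousLinearMap.apply ℝ ℝ c ∘L ContinuousLinearMap.apply ℝ _ b).hasFDerivAt.comp u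
      (hG.differentiableAt hu).hasFDerivAt).fderiv
  refine (hG.inner u hu).eq_of_forall fun c ↦ ?_
  rw [christoffel, hG.apply_christoffelL hu]
  simp only [h, ContinuousLinearMap.coe_comp, Function.comp_apply, ContinuousLinearMap.apply_apply]
  rw [sharp_spec (hG.inner u hu)]
  constructor <;> intros <;> simp <;> ring

lemma localCovDeriv_eq (hG : IsMetricOn G U) (hu : u ∈ U) (s : E → E) (a : E) :
    localCovDeriv (fun w a b ↦ G w a b) s u a = fderiv ℝ s u a + christoffelL G u a (s u) := by
  rw [localCovDeriv, hG.christoffel_eq hu]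

lemma hasFDerivAt_christoffelL_apply (hG : IsMetricOn G U) (hu : u ∈ U) {s : E → E}
    {s' : E →L[ℝ] E} (hs : HasFDerivAt s s' u) (b : E) :
    HasFDerivAt (fun w ↦ christoffelL G w b (s w))
      (((fderiv ℝ (christoffelL G) u).flip b).flip (s u) + christoffelL G u b ∘L s') u := by
  have h1 : HasFDerivAt (fun w ↦ christoffelL G w b) ((fderiv ℝ (christoffelL G) u).flip b) u := by
    have := (hG.differentiableAt_christoffelL hu).hasFDerivAt.clm_apply (hasFDerivAt_const b u)
    convert! this using 1
    ext; simp
  convert! h1.clm_apply hs using 1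
  ext; simp [add_comm]

lemma localCurvature_eq (hG : IsMetricOn G U) (hu : u ∈ U) (a b c : E) :
    localCurvature (fun w a b ↦ G w a b) u a b c = curv G u a b c := by
  have h (a b : E) : localCovDeriv (fun w a b ↦ G w a b)
      (fun w ↦ localCovDeriv (fun w a b ↦ G w a b) (fun _ ↦ c) w b) u a =
      fderiv ℝ (christoffelL G) u a b c + christoffelL G u a (christoffelL G u b c) := by
    rw [hG.localCovDeriv_eq hu, hG.localCovDeriv_eq hu]
    have h' : (fun w ↦ localCovDeriv (fun w a b ↦ G w a b) (fun _ ↦ c) w b) =ᶠ[nhds u]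
        fun w ↦ christoffelL G w b c := by
      filter_upwards [hG.isOpen.mem_nhds hu] with w hw
      rw [hG.localCovDeriv_eq hw]
      simp
    rw [h'.fderiv_eq, (hG.hasFDerivAt_christoffelL_apply hu (hasFDerivAt_const c u) b).fderiv]
    simp
  rw [localCurvature, h, h, curv]

lemma localSecondCovDeriv_eq (hG : IsMetricOn G U) (hu : u ∈ U) {s : E → E}
    (hs : ContDiffAt ℝ ∞ s u) (a b : E) :
    localSecondCovDeriv (fun w a b ↦ G w a b) s u a b =
      fderiv ℝ (fderiv ℝ s) u a b + fderiv ℝ (christoffelL G) u a b (s u) +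
        christoffelL G u b (fderiv ℝ s u a) +
        christoffelL G u a (fderiv ℝ s u b + christoffelL G u b (s u)) -
        (fderiv ℝ s u (christoffelL G u a b) + christoffelL G u (christoffelL G u a b) (s u)) := by
  have hs' : HasFDerivAt (fderiv ℝ s) (fderiv ℝ (fderiv ℝ s) u) u :=
    ((hs.fderiv_right (m := ∞) (by simp)).differentiableAt (by simp)).hasFDerivAt
  have h' : (fun w ↦ localCovDeriv (fun w a b ↦ G w a b) s w b) =ᶠ[nhds u]
      fun w ↦ fderiv ℝ s w b + christoffelL G w b (s w) := by
    filter_upwards [hG.isOpen.mem_nhds hu] with w hw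
    rw [hG.localCovDeriv_eq hw]
  have hd := (hs'.clm_apply (hasFDerivAt_const b u)).add
    (hG.hasFDerivAt_christoffelL_apply hu (hs.differentiableAt (by simp)).hasFDerivAt b)
  rw [localSecondCovDeriv, hG.localCovDeriv_eq hu, hG.localCovDeriv_eq hu, hG.localCovDeriv_eq hu,
    hG.localCovDeriv_eq hu, h'.fderiv_eq]
  have hd' : fderiv ℝ (fun w ↦ fderiv ℝ s w b + christoffelL G w b (s w)) u = _ := hd.fderiv
  rw [hd']
  simp
  abel

/-! ### Symmetries of the curvature -/

lemma fderiv_christoffelL_symm (hG : IsMetricOn G U) (hu : u ∈ U) (a b c : E) :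
    fderiv ℝ (christoffelL G) u a b c = fderiv ℝ (christoffelL G) u a c b := by
  have h' : (fun w ↦ christoffelL G w b c) =ᶠ[nhds u] fun w ↦ christoffelL G w c b := by
    filter_upwards [hG.isOpen.mem_nhds hu] with w hw using hG.christoffelL_symm hw b c
  have h1 := (hG.hasFDerivAt_christoffelL_apply hu (hasFDerivAt_const c u) b)
  have h2 := (hG.hasFDerivAt_christoffelL_apply hu (hasFDerivAt_const b u) c)
  have := congrArg (fun f : E →L[ℝ] E ↦ f a) ((h1.congr_of_eventuallyEq h'.symm).unique h2)
  simpa using this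

/-- The first Bianchi identity. -/
lemma curv_bianchi (hG : IsMetricOn G U) (hu : u ∈ U) (a b c : E) :
    curv G u a b c + curv G u b c a + curv G u c a b = 0 := by
  simp only [curv]
  rw [hG.fderiv_christoffelL_symm hu a c b, hG.fderiv_christoffelL_symm hu b c a,
    hG.fderiv_christoffelL_symm hu a b c, hG.christoffelL_symm hu c b,
    hG.christoffelL_symm hu c a, hG.christoffelL_symm hu b a, hG.fderiv_christoffelL_symm hu c b a]
  rw [hG.fderiv_christoffelL_symm hu a c b]
  abel

lemma fderiv_fderiv_apply (hG : IsMetricOn G U) (hu : u ∈ U) (d c a b : E) :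
    fderiv ℝ (fderiv ℝ G) u d c a b =
      G u (fderiv ℝ (christoffelL G) u d c a + christoffelL G u d (christoffelL G u c a)) b +
      G u (christoffelL G u c a) (christoffelL G u d b) +
      (G u (fderiv ℝ (christoffelL G) u d c b + christoffelL G u d (christoffelL G u c b)) a +
      G u (christoffelL G u c b) (christoffelL G u d a)) := by
  have hline := hasDerivAt_line u d 0
  have hu0 : u + (0 : ℝ) • d = u := by simp
  have hΓ (a : E) : HasDerivAt (fun r : ℝ ↦ christoffelL G (u + r • d) c a)
      (fderiv ℝ (christoffelL G) u d c a) 0 :=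
    ((hasDerivAt_comp_line (hG.differentiableAt_christoffelL hu) d).clm_apply_const
      c).clm_apply_const a
  have h1 (a b : E) : HasDerivAt
      (fun r : ℝ ↦ G (u + r • d) (christoffelL G (u + r • d) c a) b)
      (G u (fderiv ℝ (christoffelL G) u d c a + christoffelL G u d (christoffelL G u c a)) b +
      G u (christoffelL G u c a) (christoffelL G u d b)) 0 := by
    have := hG.hasDerivAt_inner (by rwa [hu0]) hline (hΓ a) (hasDerivAt_const (0 : ℝ) b)
    simpa only [hu0, zero_add] using this
  have h2 : HasDerivAt (fun r : ℝ ↦ fderiv ℝ G (u + r • d) c a b)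
      (fderiv ℝ (fderiv ℝ G) u d c a b) 0 := by
    have h3 : DifferentiableAt ℝ (fderiv ℝ G) u :=
      ((hG.contDiffAt hu).fderiv_right (m := ∞) (by simp)).differentiableAt (by simp)
    exact (((hasDerivAt_comp_line h3 d).clm_apply_const c).clm_apply_const a).clm_apply_const b
  have hev : (fun r : ℝ ↦ fderiv ℝ G (u + r • d) c a b) =ᶠ[nhds 0]
      fun r ↦ G (u + r • d) (christoffelL G (u + r • d) c a) b +
        G (u + r • d) (christoffelL G (u + r • d) c b) a := by
    have hn : U ∈ nhds (u + (0 : ℝ) • d) := hG.isOpen.mem_nhds (by rwa [hu0])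
    filter_upwards [hline.continuousAt.preimage_mem_nhds hn] with r hr
    rw [hG.fderiv_apply hr, hG.symm hr a]
  exact (h2.congr_of_eventuallyEq hev.symm).unique ((h1 a b).add (h1 b a))

lemma curv_skew (hG : IsMetricOn G U) (hu : u ∈ U) (c d a b : E) :
    G u (curv G u c d a) b = -G u (curv G u c d b) a := by
  have hsymm : fderiv ℝ (fderiv ℝ G) u d c = fderiv ℝ (fderiv ℝ G) u c d :=
    ((hG.contDiffAt hu).isSymmSndFDerivAt (by simpa using ENat.LEInfty.out)).eq d c
  have := hG.fderiv_fderiv_apply hu d c a b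
  rw [hsymm, hG.fderiv_fderiv_apply hu c d a b] at this
  simp only [curv, map_sub, sub_apply]
  linarith [hG.symm hu (christoffelL G u d a) (christoffelL G u c b),
    hG.symm hu (christoffelL G u d b) (christoffelL G u c a)]

/-- The pair symmetry of the curvature tensor. -/
lemma curv_pair_symm (hG : IsMetricOn G U) (hu : u ∈ U) (a b c d : E) :
    G u (curv G u a b c) d = G u (curv G u c d a) b := by
  have bi (a b c d : E) : G u (curv G u a b c) d + G u (curv G u b c a) d +
      G u (curv G u c a b) d = 0 := by
    have := congrArg (fun z ↦ G u z d) (hG.curv_bianchi hu a b c)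
    simpa using this
  have an (a b c d : E) : G u (curv G u a b c) d = -G u (curv G u b a c) d := by
    rw [curv_antisymm]; simp
  have sk := hG.curv_skew hu
  linarith [bi a b c d, bi b c d a, bi c d a b, bi d a b c, sk a b c d, sk b c a d, sk c a b d,
    sk b c d a, sk c d b a, sk d b c a, sk c d a b, sk d a c b, sk a c d b, sk d a b c,
    sk a b d c, sk b d a c, an a b c d, an b c a d, an c a b d, an d b c a, an a c d b,
    an b d a c, an c d a b, an d a b c, an c d b a, an d a c b, an a b d c, an b c d a,
    an c a d b, an d b a c]

end IsMetricOn

end LocalMetric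

/-! ### The generalised Cheeger-Gromoll metrics in a coordinate domain -/

section LocalCheegerGromoll

variable {E : Type*} [NormedAddCommGroup E] [NormedSpace ℝ E]

/-- The connection map in coordinates. -/
noncomputable def vert (G : E → E →L[ℝ] E →L[ℝ] ℝ) (z : E × E) : E × E →L[ℝ] E :=
  ContinuousLinearMap.snd ℝ E E + (christoffelL G z.1).flip z.2 ∘L ContinuousLinearMap.fst ℝ E E

/-- The metric `h_{p,q}` in coordinates. -/
noncomputable def cheegerL (G : E → E →L[ℝ] E →L[ℝ] ℝ) (p q : ℝ) (z : E × E) :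
    E × E →L[ℝ] E × E →L[ℝ] ℝ :=
  (G z.1).bilinearComp (ContinuousLinearMap.fst ℝ E E) (ContinuousLinearMap.fst ℝ E E) +
    ((1 + G z.1 z.2 z.2)⁻¹ ^ p) • ((G z.1).bilinearComp (vert G z) (vert G z) +
      q • ((G z.1).flip z.2 ∘L vert G z).smulRight ((G z.1).flip z.2 ∘L vert G z))

variable {G : E → E →L[ℝ] E →L[ℝ] ℝ} {U : Set E} {p q : ℝ}

lemma vert_apply (z A : E × E) : vert G z A = A.2 + christoffelL G z.1 A.1 z.2 := by
  simp [vert]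

lemma vert_surjective (z : E × E) (c k : E) : ∃ C : E × E, C.1 = c ∧ vert G z C = k :=
  ⟨(c, k - christoffelL G z.1 c z.2), rfl, by simp [vert_apply]⟩

lemma cheegerL_apply (z A B : E × E) : cheegerL G p q z A B =
    G z.1 A.1 B.1 + (1 + G z.1 z.2 z.2)⁻¹ ^ p * (G z.1 (vert G z A) (vert G z B) +
      q * G z.1 (vert G z A) z.2 * G z.1 (vert G z B) z.2) := by
  simp [cheegerL, ContinuousLinearMap.bilinearComp_apply, mul_assoc, mul_add]

namespace IsMetricOn

lemma one_add_pos (hG : IsMetricOn G U) {u : E} (hu : u ∈ U) (v : E) : 0 < 1 + G u v v := by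
  have := (hG.inner u hu).nonneg v
  linarith

lemma isInnerProduct_cheegerL (hG : IsMetricOn G U) (hq : 0 ≤ q) {z : E × E} (hz : z.1 ∈ U) :
    IsInnerProduct fun A B ↦ cheegerL G p q z A B where
  add_left A B C := by simp
  smul_left r A B := by simp
  symm A B := by
    rw [cheegerL_apply, cheegerL_apply, hG.symm hz A.1, hG.symm hz (vert G z A) (vert G z B)]
    ring
  pos A hA := by
    have hi := hG.inner z.1 hz
    have hf : 0 < (1 + G z.1 z.2 z.2)⁻¹ ^ p :=
      Real.rpow_pos_of_pos (inv_pos.2 (hG.one_add_pos hz z.2)) p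
    have hr : 0 ≤ q * G z.1 (vert G z A) z.2 * G z.1 (vert G z A) z.2 := by
      rw [mul_assoc]
      exact mul_nonneg hq (mul_self_nonneg _)
    rw [cheegerL_apply]
    by_cases h : A.1 = 0
    · have h2 : vert G z A ≠ 0 := by
        rw [vert_apply, h]
        simpa using fun h' ↦ hA (Prod.ext h h')
      have := hi.pos _ h2
      have h1 := hi.nonneg A.1
      positivity
    · have := hi.pos _ h
      have h1 := hi.nonneg (vert G z A)
      positivity

variable [FiniteDimensional ℝ E]

lemma contDiffAt_vert (hG : IsMetricOn G U) {z : E × E} (hz : z.1 ∈ U) (A : E × E) :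
    ContDiffAt ℝ ∞ (fun w ↦ vert G w A) z := by
  simp only [vert_apply]
  have h : ContDiffAt ℝ ∞ (fun w : E × E ↦ christoffelL G w.1) z :=
    (hG.contDiffAt_christoffelL hz).comp z contDiffAt_fst
  exact contDiffAt_const.add ((h.clm_apply contDiffAt_const).clm_apply contDiffAt_snd)

lemma contDiffAt_cheegerL_apply (hG : IsMetricOn G U) {z : E × E} (hz : z.1 ∈ U) (A B : E × E) :
    ContDiffAt ℝ ∞ (fun w ↦ cheegerL G p q w A B) z := by
  simp only [cheegerL_apply]
  have h : ContDiffAt ℝ ∞ (fun w : E × E ↦ G w.1) z := (hG.contDiffAt hz).comp z contDiffAt_fst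
  have hg {X Y : E × E → E} (hX : ContDiffAt ℝ ∞ X z) (hY : ContDiffAt ℝ ∞ Y z) :
      ContDiffAt ℝ ∞ (fun w : E × E ↦ G w.1 (X w) (Y w)) z := (h.clm_apply hX).clm_apply hY
  have hp := hG.one_add_pos hz z.2
  have hA := hG.contDiffAt_vert hz A
  have hB := hG.contDiffAt_vert hz B
  refine (hg contDiffAt_const contDiffAt_const).add (ContDiffAt.mul ?_ ((hg hA hB).add
    ((contDiffAt_const.mul (hg hA contDiffAt_snd)).mul (hg hB contDiffAt_snd))))
  refine ContDiffAt.rpow_const_of_ne ?_ (inv_pos.2 hp).ne'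
  exact (contDiffAt_const.add (hg contDiffAt_snd contDiffAt_snd)).inv hp.ne'

lemma isMetricOn_cheegerL (hG : IsMetricOn G U) (hq : 0 ≤ q) :
    IsMetricOn (cheegerL G p q) (U ×ˢ Set.univ) where
  isOpen := hG.isOpen.prod isOpen_univ
  contDiffOn := by
    rw [contDiffOn_clm_apply]
    intro A
    rw [contDiffOn_clm_apply]
    intro B z hz
    exact (hG.contDiffAt_cheegerL_apply hz.1 A B).contDiffWithinAt
  inner z hz := hG.isInnerProduct_cheegerL hq hz.1

/-- The covariant derivative in the direction `C` of the vertical part of the constant field `A`. -/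
lemma hasDerivAt_vert (hG : IsMetricOn G U) {z : E × E} (hz : z.1 ∈ U) (A C : E × E) :
    HasDerivAt (fun r : ℝ ↦ vert G (z + r • C) A)
      (fderiv ℝ (christoffelL G) z.1 C.1 A.1 z.2 + christoffelL G z.1 A.1 C.2) 0 := by
  have h1 := ((hasDerivAt_comp_line (hG.differentiableAt_christoffelL hz) C.1).clm_apply_const
    A.1).clm_apply (hasDerivAt_line z.2 C.2 0)
  simp only [vert_apply]
  simpa using h1.const_add A.2

lemma fderiv_cheegerL (hG : IsMetricOn G U) (hq : 0 ≤ q) {u v : E} (hu : u ∈ U) (A B C : E × E)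
    {D : E × E → E} (hD : ∀ A, D A = fderiv ℝ (christoffelL G) u C.1 A.1 v +
      christoffelL G u A.1 C.2 + christoffelL G u C.1 (vert G (u, v) A)) {k : E × E → E}
    (hk : ∀ A, k A = vert G (u, v) A) :
    fderiv ℝ (cheegerL G p q) (u, v) C A B =
      G u (christoffelL G u C.1 A.1) B.1 + G u A.1 (christoffelL G u C.1 B.1) +
      (1 + G u v v)⁻¹ ^ p *
        (-(2 * p * (1 + G u v v)⁻¹ * G u (k C) v) * (G u (k A) (k B) +
            q * G u (k A) v * G u (k B) v) +
          (G u (D A) (k B) + G u (k A) (D B) +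
            q * ((G u (D A) v + G u (k A) (k C)) * G u (k B) v +
              G u (k A) v * (G u (D B) v + G u (k B) (k C))))) := by
  have hz : ((u, v) : E × E) ∈ U ×ˢ Set.univ := ⟨hu, trivial⟩
  have hl := hasDerivAt_line u C.1 0
  have hu0 : u + (0 : ℝ) • C.1 = u := by simp
  have hv0 : v + (0 : ℝ) • C.2 = v := by simp
  have hz0 : (u, v) + (0 : ℝ) • C = (u, v) := by simp
  have hg {X Y : ℝ → E} {x y : E} (hX : HasDerivAt X x 0) (hY : HasDerivAt Y y 0) :
      HasDerivAt (fun r : ℝ ↦ G (u + r • C.1) (X r) (Y r)) (G u (x + christoffelL G u C.1 (X 0))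
        (Y 0) + G u (X 0) (y + christoffelL G u C.1 (Y 0))) 0 := by
    have := hG.hasDerivAt_inner (by rwa [hu0]) hl hX hY
    simpa only [hu0] using this
  have hA (A : E × E) := hG.hasDerivAt_vert (z := (u, v)) hu A C
  have hV := hasDerivAt_line v C.2 0
  have hpos := hG.one_add_pos hu v
  have hω : HasDerivAt (fun r : ℝ ↦ (1 + G (u + r • C.1) (v + r • C.2) (v + r • C.2))⁻¹ ^ p)
      ((1 + G u v v)⁻¹ ^ p * -(2 * p * (1 + G u v v)⁻¹ * G u (k C) v)) 0 := by
    have h1 := (((hg hV hV).const_add 1).inv (by simpa only [hu0, hv0] using hpos.ne')).rpow_const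
      (p := p) (Or.inl (by simpa only [hu0, hv0, Pi.inv_apply] using (inv_pos.2 hpos).ne'))
    convert! h1 using 1
    simp only [hu0, hv0, Pi.inv_apply]
    rw [Real.rpow_sub_one (inv_pos.2 hpos).ne', hG.symm hu v (_ + _), hk, vert_apply]
    field_simp
    ring
  have hKK : HasDerivAt
      (fun r : ℝ ↦ G (u + r • C.1) (vert G ((u, v) + r • C) A) (vert G ((u, v) + r • C) B))
      (G u (D A) (k B) + G u (k A) (D B)) 0 := by
    refine (hg (hA A) (hA B)).congr_deriv ?_
    rw [hz0, hk, hk, hD, hD]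
  have hKv (A : E × E) : HasDerivAt
      (fun r : ℝ ↦ G (u + r • C.1) (vert G ((u, v) + r • C) A) (v + r • C.2))
      (G u (D A) v + G u (k A) (k C)) 0 := by
    refine (hg (hA A) hV).congr_deriv ?_
    rw [hz0, hv0, hk, hk, hD, vert_apply (u, v) C]
  have hh : HasDerivAt (fun r : ℝ ↦ G (u + r • C.1) A.1 B.1)
      (G u (christoffelL G u C.1 A.1) B.1 + G u A.1 (christoffelL G u C.1 B.1)) 0 := by
    simpa only [zero_add] using hg (hasDerivAt_const (0 : ℝ) A.1) (hasDerivAt_const (0 : ℝ) B.1)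
  have h2 := ((hasDerivAt_comp_line ((hG.isMetricOn_cheegerL (p := p) hq).differentiableAt hz)
    C).clm_apply_const A).clm_apply_const B
  have key := hh.fun_add (hω.fun_mul (hKK.fun_add (((hKv A).const_mul q).fun_mul (hKv B))))
  have hev : (fun r : ℝ ↦ cheegerL G p q ((u, v) + r • C) A B) =
      fun r ↦ G (u + r • C.1) A.1 B.1 +
        (1 + G (u + r • C.1) (v + r • C.2) (v + r • C.2))⁻¹ ^ p *
        (G (u + r • C.1) (vert G ((u, v) + r • C) A) (vert G ((u, v) + r • C) B) +
        q * G (u + r • C.1) (vert G ((u, v) + r • C) A) (v + r • C.2) *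
          G (u + r • C.1) (vert G ((u, v) + r • C) B) (v + r • C.2)) :=
    funext fun r ↦ cheegerL_apply _ _ _
  rw [hev] at h2
  rw [h2.unique key]
  simp only [hu0, hv0, hz0, hk]
  ring

end IsMetricOn

end LocalCheegerGromoll

section LocalTension

variable {E : Type*} [NormedAddCommGroup E] [NormedSpace ℝ E] [FiniteDimensional ℝ E]
  {G : E → E →L[ℝ] E →L[ℝ] ℝ} {U : Set E} {p q : ℝ}

namespace IsMetricOn

/-- The inner product of the second fundamental form of a vector field with a tangent vector `C`
of the tangent bundle. -/
lemma cheegerL_secondFundamentalForm (hG : IsMetricOn G U) (hq : 0 ≤ q) {u v : E} (hu : u ∈ U)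
    (a α β : E) (C : E × E) {N W κ : E} (hN : N = α + christoffelL G u a v)
    (hW : W = β - christoffelL G u (christoffelL G u a a) v +
      (fderiv ℝ (christoffelL G) u a a v + christoffelL G u a α + christoffelL G u a N))
    (hκ : κ = vert G (u, v) C) :
    cheegerL G p q (u, v)
        ((-christoffelL G u a a, β) +
          christoffelL (cheegerL G p q) (u, v) (a, α) (a, α)) C =
      (1 + G u v v)⁻¹ ^ p * (G u W κ + q * G u W v * G u κ v + G u N (curv G u a C.1 v) +
        q * G u N N * G u κ v - p * (1 + G u v v)⁻¹ * (2 * G u N v * (G u N κ +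
          q * G u N v * G u κ v) - G u κ v * (G u N N + q * G u N v ^ 2))) := by
  have hz : ((u, v) : E × E) ∈ U ×ˢ Set.univ := ⟨hu, trivial⟩
  have hA : vert G (u, v) (a, α) = N := by rw [vert_apply, hN]
  set P : E := fderiv ℝ (christoffelL G) u a a v + christoffelL G u a α + christoffelL G u a N
    with hP
  set D : E := fderiv ℝ (christoffelL G) u C.1 a v + christoffelL G u a C.2 +
    christoffelL G u C.1 N with hD
  have hDC : fderiv ℝ (christoffelL G) u a C.1 v + christoffelL G u C.1 α +
      christoffelL G u a κ = D + curv G u a C.1 v := by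
    rw [hD, hN, hκ, vert_apply, curv]
    simp only [map_add]
    abel
  have h1 := hG.fderiv_cheegerL (p := p) hq hu (a, α) C (a, α)
    (D := fun A ↦ fderiv ℝ (christoffelL G) u a A.1 v +
      christoffelL G u A.1 α + christoffelL G u a (vert G (u, v) A)) (fun _ ↦ rfl)
    (k := fun A ↦ vert G (u, v) A) (fun _ ↦ rfl)
  have h2 := hG.fderiv_cheegerL (p := p) hq hu (a, α) (a, α) C
    (D := fun A ↦ fderiv ℝ (christoffelL G) u C.1 A.1 v +
      christoffelL G u A.1 C.2 + christoffelL G u C.1 (vert G (u, v) A)) (fun _ ↦ rfl)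
    (k := fun A ↦ vert G (u, v) A) (fun _ ↦ rfl)
  simp only [hA, ← hκ, hDC, ← hP, ← hD] at h1 h2
  have hF : vert G (u, v) (-christoffelL G u a a, β) = W - P := by
    rw [vert_apply, hW]
    simp only [map_neg, neg_apply]
    abel
  have hR : G u (curv G u a C.1 v) v = 0 := by linarith [hG.curv_skew hu a C.1 v v]
  rw [map_add, add_apply, (hG.isMetricOn_cheegerL hq).apply_christoffelL hz, cheegerL_apply, h1, h2,
    hF, ← hκ]
  simp only [map_add, map_sub, map_neg, sub_apply, neg_apply, add_apply]
  rw [hG.symm hu N D, hG.symm hu κ N, hR, hG.christoffelL_symm hu C.1 a,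
    hG.symm hu a (christoffelL G u a C.1)]
  ring

end IsMetricOn

omit [FiniteDimensional ℝ E] in
/-- The vanishing of the tension field, tested against horizontal and vertical vectors. -/
lemma tension_algebra {g : E → E → ℝ} (hg : IsInnerProduct g) (hq : 0 ≤ q) {v R W X : E}
    {c n x : ℝ} (hX : g X v = x) :
    (∀ k m, g W k + q * g W v * g k v + g R m + q * n * g k v -
      c * (2 * (g X k + q * x * g k v) - g k v * (n + q * x)) = 0) ↔
    R = 0 ∧ -W + (2 * c) • X =
      ((c + q) / (1 + q * g v v) * n + c * q / (1 + q * g v v) * x) • v := by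
  have hv := hg.nonneg v
  have hpos : 0 < 1 + q * g v v := by positivity
  have hsymm := hg.symm
  constructor
  · intro h
    have hR : R = 0 := by
      rw [hg.eq_zero_iff_forall]
      intro m
      simpa [hg.zero_left, hg.zero_right] using h 0 m
    refine ⟨hR, hg.eq_of_forall fun k ↦ ?_⟩
    have h1 := h v 0
    have h2 := h k 0
    rw [hg.zero_right] at h1 h2
    rw [hg.add_left, hg.neg_left, hg.smul_left, hg.smul_left]
    rw [hX] at h1
    field_simp
    rw [hsymm v k]
    linear_combination (-(1 + q * g v v)) * h2 + q * g k v * h1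
  · rintro ⟨hR, h⟩ k m
    have key (k : E) : (-g W k + 2 * c * g X k) * (1 + q * g v v) =
        ((c + q) * n + c * q * x) * g k v := by
      have := congrArg (fun z ↦ g z k) h
      simp only [hg.add_left, hg.neg_left, hg.smul_left] at this
      rw [this, hsymm v k]
      field_simp
    have h1 := key v
    have h2 := key k
    rw [hX] at h1
    rw [hR, hg.zero_left]
    have : (1 + q * g v v) * (g W k + q * g W v * g k v + 0 + q * n * g k v -
      c * (2 * (g X k + q * x * g k v) - g k v * (n + q * x))) = 0 := by
      linear_combination (-1) * h2 - q * g k v * h1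
    exact (mul_eq_zero.1 this).resolve_left hpos.ne'

lemma christoffel_congr {V : Type*} [NormedAddCommGroup V] [NormedSpace ℝ V]
    [FiniteDimensional ℝ V] {H₁ H₂ : V → V → V → ℝ} {z : V} (h : H₁ =ᶠ[nhds z] H₂) (a b : V) :
    christoffel H₁ z a b = christoffel H₂ z a b := by
  have h' (a b : V) : fderiv ℝ (fun w ↦ H₁ w a b) z = fderiv ℝ (fun w ↦ H₂ w a b) z := by
    apply Filter.EventuallyEq.fderiv_eq
    filter_upwards [h] with w hw
    rw [hw]
  simp only [christoffel, h', h.self_of_nhds]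

/-- A vector field on a coordinate domain is a harmonic map at a point if and only if both
equations hold at this point. -/
theorem local_tension_eq_zero_iff (hG : IsMetricOn G U) (hq : 0 ≤ q) {u : E} (hu : u ∈ U)
    {s : E → E} (hs : ContDiffAt ℝ ∞ s u) {φ : E → E × E} (hφ : φ =ᶠ[nhds u] fun w ↦ (w, s w))
    {H : E × E → E × E → E × E → ℝ}
    (hH : H =ᶠ[nhds (u, s u)] fun z A B ↦ cheegerL G p q z A B)
    {ι : Type*} [Fintype ι] [DecidableEq ι] (e : Module.Basis ι ℝ E)
    (he : ∀ i j, G u (e i) (e j) = if i = j then 1 else 0) :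
    metricTrace (fun a b ↦ G u a b) (fun a b ↦
        fderiv ℝ (fun w ↦ fderiv ℝ φ w b) u a
          - fderiv ℝ φ u (christoffel (fun w a b ↦ G w a b) u a b)
          + christoffel H (u, s u) (fderiv ℝ φ u a) (fderiv ℝ φ u b)) = 0 ↔
      ∑ i, localCurvature (fun w a b ↦ G w a b) u (s u)
        (localCovDeriv (fun w a b ↦ G w a b) s u (e i)) (e i) = 0 ∧
      -metricTrace (fun a b ↦ G u a b) (localSecondCovDeriv (fun w a b ↦ G w a b) s u) +
          (2 * p * (1 + G u (s u) (s u))⁻¹) • localCovDeriv (fun w a b ↦ G w a b) s u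
            (sharp (fun a b ↦ G u a b) (fderiv ℝ (fun w ↦ G w (s w) (s w) / 2) u)) =
        ((p * (1 + G u (s u) (s u))⁻¹ + q) / (1 + q * G u (s u) (s u)) *
            metricTrace (fun a b ↦ G u a b) (fun a b ↦
              G u (localCovDeriv (fun w a b ↦ G w a b) s u a)
                (localCovDeriv (fun w a b ↦ G w a b) s u b)) +
          p * q * (1 + G u (s u) (s u))⁻¹ / (1 + q * G u (s u) (s u)) *
            G u (sharp (fun a b ↦ G u a b) (fderiv ℝ (fun w ↦ G w (s w) (s w) / 2) u))
              (sharp (fun a b ↦ G u a b) (fderiv ℝ (fun w ↦ G w (s w) (s w) / 2) u))) • s u := by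
  have hi := hG.inner u hu
  have hHm := hG.isMetricOn_cheegerL (p := p) hq
  have hz : (u, s u) ∈ U ×ˢ (Set.univ : Set E) := ⟨hu, trivial⟩
  set v := s u with hv
  set f := (1 + G u v v)⁻¹ ^ p with hf
  have hfpos : 0 < f := Real.rpow_pos_of_pos (inv_pos.2 (hG.one_add_pos hu v)) p
  set N : E → E := fun a ↦ fderiv ℝ s u a + christoffelL G u a v with hN
  set W : E → E → E := localSecondCovDeriv (fun w a b ↦ G w a b) s u with hW
  have hcov (a : E) : localCovDeriv (fun w a b ↦ G w a b) s u a = N a := hG.localCovDeriv_eq hu s a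
  have hcurv (a b c : E) : localCurvature (fun w a b ↦ G w a b) u a b c = curv G u a b c :=
    hG.localCurvature_eq hu a b c
  have hW' := hG.localSecondCovDeriv_eq hu hs
  rw [← hW] at hW'
  have hsd : HasFDerivAt s (fderiv ℝ s u) u := (hs.differentiableAt (by simp)).hasFDerivAt
  have hφd : ∀ᶠ w in nhds u, fderiv ℝ φ w = (ContinuousLinearMap.id ℝ E).prod (fderiv ℝ s w) := by
    have h1 : ∀ᶠ w in nhds u, DifferentiableAt ℝ s w :=
      ((hs.of_le (m := 1) (by simp)).eventually (by simp)).mono fun w hw ↦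
        hw.differentiableAt (by simp)
    filter_upwards [hφ.eventuallyEq_nhds, h1] with w hw hw'
    rw [hw.fderiv_eq]
    exact ((hasFDerivAt_id w).prodMk hw'.hasFDerivAt).fderiv
  have hφu (a : E) : fderiv ℝ φ u a = (a, fderiv ℝ s u a) := by
    rw [hφd.self_of_nhds]; rfl
  have hφ2 (a b : E) :
      fderiv ℝ (fun w ↦ fderiv ℝ φ w b) u a = (0, fderiv ℝ (fderiv ℝ s) u a b) := by
    have h1 : (fun w ↦ fderiv ℝ φ w b) =ᶠ[nhds u] fun w ↦ (b, fderiv ℝ s w b) := by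
      filter_upwards [hφd] with w hw
      rw [hw]; rfl
    have h2 : HasFDerivAt (fderiv ℝ s) (fderiv ℝ (fderiv ℝ s) u) u :=
      ((hs.fderiv_right (m := ∞) (by simp)).differentiableAt (by simp)).hasFDerivAt
    rw [h1.fderiv_eq, ((hasFDerivAt_const b u).prodMk
      (h2.clm_apply (hasFDerivAt_const b u))).fderiv]
    simp
  have hB (a b : E) : fderiv ℝ (fun w ↦ fderiv ℝ φ w b) u a
      - fderiv ℝ φ u (christoffel (fun w a b ↦ G w a b) u a b)
      + christoffel H (u, v) (fderiv ℝ φ u a) (fderiv ℝ φ u b) =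
      (-christoffelL G u a b, fderiv ℝ (fderiv ℝ s) u a b - fderiv ℝ s u (christoffelL G u a b)) +
        christoffelL (cheegerL G p q) (u, v) (a, fderiv ℝ s u a) (b, fderiv ℝ s u b) := by
    rw [hφ2, hφu, hφu, hφu, hG.christoffel_eq hu, christoffel_congr hH, hHm.christoffel_eq hz]
    congr 1
    simp
  simp only [hB, hcov, hcurv]
  have hNlin : IsLinearMap ℝ N := by
    constructor <;> intros <;> simp [hN] <;> abel
  set X := sharp (fun a b ↦ G u a b) (fderiv ℝ (fun w ↦ G w (s w) (s w) / 2) u) with hX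
  have hXspec (a : E) : G u X a = G u (N a) v := by
    have h0 : DifferentiableAt ℝ (fun w ↦ G w (s w) (s w)) u :=
      ((hG.differentiableAt hu).clm_apply hsd.differentiableAt).clm_apply hsd.differentiableAt
    have hd : DifferentiableAt ℝ (fun w ↦ G w (s w) (s w) / 2) u := by
      simpa only [div_eq_mul_inv] using h0.mul_const (2 : ℝ)⁻¹
    have hl := hasDerivAt_line u a 0
    have hu0 : u + (0 : ℝ) • a = u := by simp
    have hsl := hasDerivAt_comp_line hsd.differentiableAt a
    have h1 := (hG.hasDerivAt_inner (by rwa [hu0]) hl hsl hsl).div_const 2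
    simp only [hu0, ← hv] at h1
    rw [hX, sharp_spec hi ⟨map_add _, map_smul _⟩,
      (hasDerivAt_comp_line hd a).unique h1, hG.symm hu v]
    ring
  set J : E →L[ℝ] E × E := (ContinuousLinearMap.id ℝ E).prod (fderiv ℝ s u) with hJ
  have hJa (a : E) : (a, fderiv ℝ s u a) = J a := rfl
  rw [metricTrace_eq_sum hi e he _ (by
      intro b
      simp only [hJa]
      constructor <;> intros <;> refine Prod.ext ?_ ?_ <;> simp [smul_sub] <;> abel) (by
      intro b
      simp only [hJa]
      constructor <;> intros <;> refine Prod.ext ?_ ?_ <;> simp [smul_sub] <;> abel),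
    metricTrace_eq_sum hi e he W (by
      intro b
      simp only [hW']
      constructor <;> intros <;> simp [smul_sub, smul_add] <;> abel) (by
      intro b
      constructor <;> intros <;> simp [hW', smul_sub, smul_add] <;> abel),
    metricTrace_eq_sum hi e he _ (by
      intro b
      constructor <;> intros <;> simp [hNlin.map_add, hNlin.map_smul]) (by
      intro b
      constructor <;> intros <;> simp [hNlin.map_add, hNlin.map_smul])]
  have hXsum : X = ∑ i, G u (N (e i)) v • e i := by
    conv_lhs => rw [← e.sum_repr X]
    refine Finset.sum_congr rfl fun i _ ↦ ?_
    have h : G u (∑ j, e.repr X j • e j) (e i) = e.repr X i := by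
      simp only [map_sum, sum_apply, map_smul, smul_apply, he, smul_eq_mul]
      simp
    rw [← hXspec, ← h, e.sum_repr]
  have hNX : N X = ∑ i, G u (N (e i)) v • N (e i) := by
    rw [hXsum, hNlin.map_finset_sum]
    exact Finset.sum_congr rfl fun i _ ↦ hNlin.map_smul _ _
  have hXX : G u X X = ∑ i, G u (N (e i)) v ^ 2 := by
    rw [hXspec, hNX]
    simp [sq]
  have hNXv : G u (N X) v = G u X X := (hXspec X).symm
  have halg := tension_algebra hi hq (v := v) (R := ∑ i, curv G u v (N (e i)) (e i))
    (W := ∑ i, W (e i) (e i)) (c := p * (1 + G u v v)⁻¹) (n := ∑ i, G u (N (e i)) (N (e i))) hNXv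
  rw [show 2 * p * (1 + G u v v)⁻¹ = 2 * (p * (1 + G u v v)⁻¹) by ring,
    show p * q * (1 + G u v v)⁻¹ = p * (1 + G u v v)⁻¹ * q by ring, ← halg,
    (hHm.inner _ hz).eq_zero_iff_forall]
  have hsum (C : E × E) := by
    calc cheegerL G p q (u, v) (∑ i, ((-christoffelL G u (e i) (e i),
          fderiv ℝ (fderiv ℝ s) u (e i) (e i) - fderiv ℝ s u (christoffelL G u (e i) (e i))) +
          christoffelL (cheegerL G p q) (u, v) (e i, fderiv ℝ s u (e i))
            (e i, fderiv ℝ s u (e i)))) C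
        = ∑ i, f * (G u (W (e i) (e i)) (vert G (u, v) C) +
            q * G u (W (e i) (e i)) v * G u (vert G (u, v) C) v +
            G u (N (e i)) (curv G u (e i) C.1 v) +
            q * G u (N (e i)) (N (e i)) * G u (vert G (u, v) C) v - p * (1 + G u v v)⁻¹ *
            (2 * G u (N (e i)) v * (G u (N (e i)) (vert G (u, v) C) +
              q * G u (N (e i)) v * G u (vert G (u, v) C) v) - G u (vert G (u, v) C) v *
              (G u (N (e i)) (N (e i)) + q * G u (N (e i)) v ^ 2))) := by
          rw [map_sum, sum_apply]
          refine Finset.sum_congr rfl fun i _ ↦ ?_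
          refine hG.cheegerL_secondFundamentalForm hq hu _ _ _ C rfl ?_ rfl
          rw [hW', hN]
          simp only [map_add]
          abel
      _ = f * (G u (∑ i, W (e i) (e i)) (vert G (u, v) C) +
            q * G u (∑ i, W (e i) (e i)) v * G u (vert G (u, v) C) v +
            G u (∑ i, curv G u v (N (e i)) (e i)) C.1 +
            q * (∑ i, G u (N (e i)) (N (e i))) * G u (vert G (u, v) C) v -
            p * (1 + G u v v)⁻¹ * (2 * (G u (N X) (vert G (u, v) C) +
              q * G u X X * G u (vert G (u, v) C) v) - G u (vert G (u, v) C) v *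
              (∑ i, G u (N (e i)) (N (e i)) + q * G u X X))) := by
          rw [hXX, hNX]
          simp only [map_sum, sum_apply, Finset.mul_sum, Finset.sum_mul,
            ← Finset.sum_add_distrib, ← Finset.sum_sub_distrib, map_smul, smul_apply, smul_eq_mul]
          refine Finset.sum_congr rfl fun i _ ↦ ?_
          rw [hG.curv_pair_symm hu v (N (e i)), hG.symm hu (N (e i)) (curv G u (e i) C.1 v)]
          ring
  simp only [hsum, mul_eq_zero, hfpos.ne', false_or]
  refine ⟨fun h k m ↦ ?_, fun h C ↦ h _ _⟩
  obtain ⟨C, rfl, rfl⟩ := vert_surjective (G := G) (u, v) m k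
  exact h C

end LocalTension

section ChangeOfCoordinates

variable {E : Type*} [NormedAddCommGroup E] [NormedSpace ℝ E] [FiniteDimensional ℝ E]

/-- The transformation law of the Christoffel symbols. -/
lemma IsMetricOn.christoffelL_comp {G₁ G₂ : E → E →L[ℝ] E →L[ℝ] ℝ} {U₁ U₂ : Set E}
    (hG₁ : IsMetricOn G₁ U₁) (hG₂ : IsMetricOn G₂ U₂) {ψ : E → E} {u : E} (hu : u ∈ U₁)
    (hψu : ψ u ∈ U₂) (hψ : ContDiffAt ℝ ∞ ψ u) (hsurj : Function.Surjective (fderiv ℝ ψ u))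
    (hpull : ∀ᶠ w in nhds u, ∀ a b, G₂ (ψ w) (fderiv ℝ ψ w a) (fderiv ℝ ψ w b) = G₁ w a b)
    (a b : E) :
    fderiv ℝ (fderiv ℝ ψ) u a b + christoffelL G₂ (ψ u) (fderiv ℝ ψ u a) (fderiv ℝ ψ u b) =
      fderiv ℝ ψ u (christoffelL G₁ u a b) := by
  set S : E → E → E := fun a b ↦
    fderiv ℝ (fderiv ℝ ψ) u a b + christoffelL G₂ (ψ u) (fderiv ℝ ψ u a) (fderiv ℝ ψ u b) with hS
  have hSsymm (a b : E) : S a b = S b a := by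
    have h1 : fderiv ℝ (fderiv ℝ ψ) u a b = fderiv ℝ (fderiv ℝ ψ) u b a :=
      (hψ.isSymmSndFDerivAt (by simpa using ENat.LEInfty.out)).eq a b
    rw [hS]
    simp only
    rw [h1, hG₂.christoffelL_symm hψu]
  have hd (c a b : E) : fderiv ℝ G₁ u c a b =
      G₂ (ψ u) (S c a) (fderiv ℝ ψ u b) + G₂ (ψ u) (fderiv ℝ ψ u a) (S c b) := by
    have hu0 : u + (0 : ℝ) • c = u := by simp
    have h1 := hasDerivAt_comp_line (hψ.differentiableAt (by simp)) c
    have hψ' : DifferentiableAt ℝ (fderiv ℝ ψ) u :=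
      (hψ.fderiv_right (m := ∞) (by simp)).differentiableAt (by simp)
    have h2 (a : E) := (hasDerivAt_comp_line hψ' c).clm_apply_const a
    have h3 := hG₂.hasDerivAt_inner (by rwa [hu0]) h1 (h2 a) (h2 b)
    have h4 := ((hasDerivAt_comp_line (hG₁.differentiableAt hu) c).clm_apply_const
      a).clm_apply_const b
    have hev : (fun r : ℝ ↦ G₂ (ψ (u + r • c)) (fderiv ℝ ψ (u + r • c) a)
        (fderiv ℝ ψ (u + r • c) b)) =ᶠ[nhds 0] fun r ↦ G₁ (u + r • c) a b := by
      rw [← hu0] at hpull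
      filter_upwards [(hasDerivAt_line u c 0).continuousAt.eventually hpull] with r hr
      exact hr a b
    rw [(h4.congr_of_eventuallyEq hev).unique h3]
    simp only [hu0, hS]
  refine (hG₂.inner _ hψu).eq_of_forall fun c ↦ ?_
  obtain ⟨c, rfl⟩ := hsurj c
  change G₂ (ψ u) (S a b) _ = _
  rw [hpull.self_of_nhds, hG₁.apply_christoffelL hu, hd, hd, hd, hSsymm b a, hSsymm c a,
    hSsymm c b, hG₂.symm hψu (fderiv ℝ ψ u a), hG₂.symm hψu (fderiv ℝ ψ u b)]
  ring

end ChangeOfCoordinates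

section Charts

variable {E : Type*} [NormedAddCommGroup E] [NormedSpace ℝ E]
  {H : Type*} [TopologicalSpace H] {I : ModelWithCorners ℝ E H} [I.Boundaryless]
  {M : Type*} [TopologicalSpace M] [ChartedSpace H M] [IsManifold I 1 M]

lemma mdifferentiableAt_extChartAt_symm {x : M} {u : E} (hu : u ∈ (extChartAt I x).target) :
    MDifferentiableAt 𝓘(ℝ, E) I (extChartAt I x).symm u := by
  have := mdifferentiableWithinAt_extChartAt_symm hu
  rwa [I.range_eq_univ, mdifferentiableWithinAt_univ] at this

lemma mfderiv_extChartAt_symm_self (x : M) :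
    mfderiv 𝓘(ℝ, E) I (extChartAt I x).symm (extChartAt I x x) = ContinuousLinearMap.id ℝ E := by
  have := mfderivWithin_range_extChartAt_symm (I := I) (x := x)
  rwa [I.range_eq_univ, mfderivWithin_univ] at this

lemma extChartAt_tangent_symm_apply (e : TangentBundle I M) {u : E} (v : E)
    (hu : u ∈ (extChartAt I e.proj).target) :
    (extChartAt I.tangent e).symm (u, v) =
      (⟨(extChartAt I e.proj).symm u, mfderiv 𝓘(ℝ, E) I (extChartAt I e.proj).symm u v⟩ :
        TangentBundle I M) := by
  have hu' : I.symm u ∈ (chartAt H e.proj).target := by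
    simpa [extChartAt_target, I.range_eq_univ] using hu
  have h1 := tangentMap_chart_symm (I := I) (p := e) (q := ⟨I.symm u, v⟩) hu'
  have h2 : HasMFDerivAt 𝓘(ℝ, E) I I.symm u (ContinuousLinearMap.id ℝ E) := by
    have := I.hasMFDerivWithinAt_symm (x := u) (by simp [I.range_eq_univ])
    rw [I.range_eq_univ] at this
    exact hasMFDerivWithinAt_univ.1 this
  have h3 : MDifferentiableAt I I (chartAt H e.proj).symm (I.symm u) :=
    mdifferentiableAt_atlas_symm (chart_mem_atlas _ _) hu'
  have h4 : mfderiv 𝓘(ℝ, E) I (extChartAt I e.proj).symm u =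
      (mfderiv I I (chartAt H e.proj).symm (I.symm u)).comp (ContinuousLinearMap.id ℝ E) :=
    (h3.hasMFDerivAt.comp u h2).mfderiv
  rw [h4]
  exact h1.symm

omit [I.Boundaryless] in
lemma extChartAt_tangent_apply (e e' : TangentBundle I M)
    (h : e'.proj ∈ (extChartAt I e.proj).source) :
    extChartAt I.tangent e e' =
      (extChartAt I e.proj e'.proj, mfderiv I 𝓘(ℝ, E) (extChartAt I e.proj) e'.proj e'.snd) := by
  have h' : e'.proj ∈ (chartAt H e.proj).source := by rwa [← extChartAt_source (I := I)]
  have h1 := tangentMap_chart (I := I) (p := e) (q := e') h'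
  have h4 : mfderiv I 𝓘(ℝ, E) (extChartAt I e.proj) e'.proj =
      (ContinuousLinearMap.id ℝ E).comp (mfderiv I I (chartAt H e.proj) e'.proj) :=
    (I.hasMFDerivAt.comp e'.proj
      (mdifferentiableAt_atlas (chart_mem_atlas _ _) h').hasMFDerivAt).mfderiv
  rw [h4]
  have h5 : chartAt (ModelProd H E) e e' = TotalSpace.toProd H E (tangentMap I I
    (chartAt H e.proj) e') := by rw [h1]; rfl
  have h6 : extChartAt I.tangent e e' = I.tangent (chartAt (ModelProd H E) e e') := rfl
  rw [h6, h5]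
  rfl

lemma mem_extChartAt_tangent_target (e : TangentBundle I M) (u v : E) :
    (u, v) ∈ (extChartAt I.tangent e).target ↔ u ∈ (extChartAt I e.proj).target := by
  rw [extChartAt_target, extChartAt_target, I.range_eq_univ, I.tangent.range_eq_univ,
    Set.inter_univ, Set.inter_univ]
  exact TangentBundle.mem_chart_target_iff (I.symm u, v) e

end Charts

lemma IsInnerProduct.comp {V W : Type*} [AddCommGroup V] [Module ℝ V] [AddCommGroup W] [Module ℝ W]
    {g : W → W → ℝ} (hg : IsInnerProduct g) (f : V →ₗ[ℝ] W) (hf : Function.Injective f) :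
    IsInnerProduct fun a b ↦ g (f a) (f b) where
  add_left a b c := by rw [map_add, hg.add_left]
  smul_left r a b := by rw [map_smul, hg.smul_left]
  symm a b := hg.symm _ _
  pos a ha := hg.pos _ fun h ↦ ha ((injective_iff_map_eq_zero f).1 hf a h)

section MetricInCharts

variable {E : Type*} [NormedAddCommGroup E] [NormedSpace ℝ E]
  {H : Type*} [TopologicalSpace H] {I : ModelWithCorners ℝ E H}
  {M : Type*} [TopologicalSpace M] [ChartedSpace H M] [IsManifold I ∞ M]

/-- The derivative of the inverse of the preferred chart at `x`. -/
noncomputable def dSymm (I : ModelWithCorners ℝ E H) (x : M) (u : E) : E →L[ℝ] E :=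
  mfderiv 𝓘(ℝ, E) I (extChartAt I x).symm u

/-- The inner product at `x`, as a bilinear map on the model space. -/
noncomputable def innerL (metric : ContMDiffRiemannianMetric I ∞ E (fun x : M ↦ TangentSpace I x))
    (x : M) : E →L[ℝ] E →L[ℝ] ℝ :=
  metric.inner x

/-- The coefficients of the metric in the preferred chart at `x`, as a bilinear map. -/
noncomputable def metricL (metric : ContMDiffRiemannianMetric I ∞ E (fun x : M ↦ TangentSpace I x))
    (x : M) (u : E) : E →L[ℝ] E →L[ℝ] ℝ :=
  (innerL metric ((extChartAt I x).symm u)).bilinearComp (dSymm I x u) (dSymm I x u)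

variable {metric : ContMDiffRiemannianMetric I ∞ E (fun x : M ↦ TangentSpace I x)}

lemma metricInChart_toFormField (x : M) :
    metricInChart (toFormField metric) x = fun u a b ↦ metricL metric x u a b := rfl

lemma metricL_apply (x : M) (u a b : E) : metricL metric x u a b =
    innerL metric ((extChartAt I x).symm u) (dSymm I x u a) (dSymm I x u b) := rfl

lemma isInnerProduct_innerL (x : M) : IsInnerProduct fun a b ↦ innerL metric x a b where
  add_left a b c := by simp
  smul_left r a b := by simp
  symm a b := metric.symm x a b
  pos a ha := metric.pos x a ha

variable [I.Boundaryless]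

lemma dSymm_self (x : M) : dSymm I x (extChartAt I x x) = ContinuousLinearMap.id ℝ E :=
  mfderiv_extChartAt_symm_self x

lemma metricL_self (x : M) : metricL metric x (extChartAt I x x) = innerL metric x := by
  ext a b
  rw [metricL_apply, dSymm_self, extChartAt_to_inv]
  rfl

lemma dSymm_injective (x : M) {u : E} (hu : u ∈ (extChartAt I x).target) :
    Function.Injective (dSymm I x u) := by
  have h := isInvertible_mfderivWithin_extChartAt_symm hu
  rw [I.range_eq_univ, mfderivWithin_univ] at h
  exact h.bijective.injective

lemma dSymm_surjective (x : M) {u : E} (hu : u ∈ (extChartAt I x).target) :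
    Function.Surjective (dSymm I x u) := by
  have h := isInvertible_mfderivWithin_extChartAt_symm hu
  rw [I.range_eq_univ, mfderivWithin_univ] at h
  exact h.bijective.surjective

lemma contMDiffAt_dSymm (x : M) {u : E} (hu : u ∈ (extChartAt I x).target) (a : E) :
    ContMDiffAt 𝓘(ℝ, E) I.tangent ∞
      (fun w ↦ (⟨(extChartAt I x).symm w, dSymm I x w a⟩ : TangentBundle I M)) u := by
  set e : TangentBundle I M := ⟨x, 0⟩
  have h1 : ContMDiffAt 𝓘(ℝ, E × E) I.tangent ∞ (extChartAt I.tangent e).symm (u, a) :=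
    (contMDiffOn_extChartAt_symm e).contMDiffAt
      ((isOpen_extChartAt_target e).mem_nhds ((mem_extChartAt_tangent_target e u a).2 hu))
  have h2 : ContMDiffAt 𝓘(ℝ, E) 𝓘(ℝ, E × E) ∞ (fun w : E ↦ (w, a)) u :=
    (contDiff_id.prodMk contDiff_const).contMDiff.contMDiffAt
  refine (h1.comp u h2).congr_of_eventuallyEq ?_
  filter_upwards [(isOpen_extChartAt_target x).mem_nhds hu] with w hw
  exact (extChartAt_tangent_symm_apply e a hw).symm

variable [FiniteDimensional ℝ E]

omit [FiniteDimensional ℝ E] in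
lemma contDiffAt_metricL_apply (x : M) {u : E} (hu : u ∈ (extChartAt I x).target) (a b : E) :
    ContDiffAt ℝ ∞ (fun w ↦ metricL metric x w a b) u := by
  rw [← contMDiffAt_iff_contDiffAt]
  have hb : ContMDiffAt 𝓘(ℝ, E) I ∞ (extChartAt I x).symm u :=
    (contMDiffOn_extChartAt_symm x).contMDiffAt ((isOpen_extChartAt_target x).mem_nhds hu)
  have hm := metric.contMDiff.contMDiffAt.comp u hb
  have := hm.clm_bundle_apply₂ (F₁ := E) (F₂ := E) (F₃ := ℝ) (E₃ := Bundle.Trivial M ℝ)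
    (contMDiffAt_dSymm x hu a) (contMDiffAt_dSymm x hu b)
  exact (contMDiffAt_totalSpace.1 this).2

lemma isMetricOn_metricL (x : M) : IsMetricOn (metricL metric x) (extChartAt I x).target where
  isOpen := isOpen_extChartAt_target x
  contDiffOn := by
    rw [contDiffOn_clm_apply]
    intro a
    rw [contDiffOn_clm_apply]
    intro b u hu
    exact (contDiffAt_metricL_apply x hu a b).contDiffWithinAt
  inner _ hu := (isInnerProduct_innerL _).comp (dSymm I x _ : E →ₗ[ℝ] E) (dSymm_injective x hu)

end MetricInCharts

section ChartTransition

variable {E : Type*} [NormedAddCommGroup E] [NormedSpace ℝ E]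
  {H : Type*} [TopologicalSpace H] {I : ModelWithCorners ℝ E H} [I.Boundaryless]
  {M : Type*} [TopologicalSpace M] [ChartedSpace H M] [IsManifold I ∞ M]
  {metric : ContMDiffRiemannianMetric I ∞ E (fun x : M ↦ TangentSpace I x)}

/-- The transition map from the preferred chart at `x` to the preferred chart at `y`. -/
noncomputable def transition (I : ModelWithCorners ℝ E H) (x y : M) (u : E) : E :=
  extChartAt I y ((extChartAt I x).symm u)

variable {x y : M} {u : E}

omit [IsManifold I ∞ M] in
lemma eventually_mem_source (hu : u ∈ (extChartAt I x).target)
    (hy : (extChartAt I x).symm u ∈ (extChartAt I y).source) :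
    ∀ᶠ w in nhds u, w ∈ (extChartAt I x).target ∧
      (extChartAt I x).symm w ∈ (extChartAt I y).source := by
  have h1 := (isOpen_extChartAt_target x).mem_nhds hu
  exact (Filter.eventually_of_mem h1 fun _ h ↦ h).and
    (((continuousOn_extChartAt_symm x).continuousAt h1).preimage_mem_nhds
      ((isOpen_extChartAt_source y).mem_nhds hy))

lemma contDiffAt_transition (hu : u ∈ (extChartAt I x).target)
    (hy : (extChartAt I x).symm u ∈ (extChartAt I y).source) :
    ContDiffAt ℝ ∞ (transition I x y) u := by
  rw [← contMDiffAt_iff_contDiffAt]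
  have h1 : ContMDiffAt 𝓘(ℝ, E) I ∞ (extChartAt I x).symm u :=
    (contMDiffOn_extChartAt_symm x).contMDiffAt ((isOpen_extChartAt_target x).mem_nhds hu)
  have h2 : ContMDiffAt I 𝓘(ℝ, E) ∞ (extChartAt I y) ((extChartAt I x).symm u) :=
    contMDiffAt_extChartAt' (by rwa [← extChartAt_source (I := I)])
  exact h2.comp u h1

lemma fderiv_transition (hu : u ∈ (extChartAt I x).target)
    (hy : (extChartAt I x).symm u ∈ (extChartAt I y).source) (a : E) :
    fderiv ℝ (transition I x y) u a =
      mfderiv I 𝓘(ℝ, E) (extChartAt I y) ((extChartAt I x).symm u) (dSymm I x u a) := by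
  have h1 := (mdifferentiableAt_extChartAt_symm hu).hasMFDerivAt
  have h2 := (mdifferentiableAt_extChartAt (I := I) (x := y)
    (by rwa [← extChartAt_source (I := I)] : (extChartAt I x).symm u ∈ _)).hasMFDerivAt
  have h3 := (h2.comp u h1).mfderiv
  rw [mfderiv_eq_fderiv] at h3
  exact congrArg (fun f : E →L[ℝ] E ↦ f a) h3

lemma dSymm_transition (hu : u ∈ (extChartAt I x).target)
    (hy : (extChartAt I x).symm u ∈ (extChartAt I y).source) (a : E) :
    dSymm I y (transition I x y u) (fderiv ℝ (transition I x y) u a) = dSymm I x u a := by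
  have h0 : HasFDerivAt (transition I x y) (fderiv ℝ (transition I x y) u) u :=
    ((contDiffAt_transition hu hy).differentiableAt (by simp)).hasFDerivAt
  have h1 := h0.hasMFDerivAt
  have h2 := (mdifferentiableAt_extChartAt_symm (I := I) (x := y) (u := transition I x y u)
    ((extChartAt I y).map_source hy)).hasMFDerivAt
  have h3 : (extChartAt I y).symm ∘ transition I x y =ᶠ[nhds u] (extChartAt I x).symm := by
    filter_upwards [eventually_mem_source hu hy] with w hw
    exact (extChartAt I y).left_inv hw.2
  have h4 := ((h2.comp u h1).congr_of_eventuallyEq h3.symm).mfderiv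
  exact (congrArg (fun f : E →L[ℝ] E ↦ f a) h4).symm

lemma metricL_transition (hu : u ∈ (extChartAt I x).target)
    (hy : (extChartAt I x).symm u ∈ (extChartAt I y).source) (a b : E) :
    metricL metric y (transition I x y u) (fderiv ℝ (transition I x y) u a)
      (fderiv ℝ (transition I x y) u b) = metricL metric x u a b := by
  rw [metricL_apply, metricL_apply, dSymm_transition hu hy, dSymm_transition hu hy, transition,
    (extChartAt I y).left_inv hy]

lemma fderiv_transition_self (hu : u ∈ (extChartAt I x).target)
    (hy : (extChartAt I x).symm u = y) : fderiv ℝ (transition I x y) u = dSymm I x u := by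
  ext a
  have h := dSymm_transition (y := y) hu (by rw [hy]; exact mem_extChartAt_source y) a
  rwa [transition, hy, dSymm_self] at h

/-- The Levi-Civita connection does not depend on the chart. -/
lemma christoffelL_transition [FiniteDimensional ℝ E] (hu : u ∈ (extChartAt I x).target)
    (hy : (extChartAt I x).symm u = y) (a b : E) :
    fderiv ℝ (fderiv ℝ (transition I x y)) u a b +
        christoffelL (metricL metric y) (extChartAt I y y) (dSymm I x u a) (dSymm I x u b) =
      dSymm I x u (christoffelL (metricL metric x) u a b) := by
  have hy' : (extChartAt I x).symm u ∈ (extChartAt I y).source := by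
    rw [hy]; exact mem_extChartAt_source y
  have hψ : transition I x y u = extChartAt I y y := by rw [transition, hy]
  have h := (isMetricOn_metricL (metric := metric) x).christoffelL_comp
    (isMetricOn_metricL (metric := metric) y) hu
    (by rw [hψ]; exact mem_extChartAt_target y) (contDiffAt_transition hu hy')
    (by rw [fderiv_transition_self hu hy]; exact dSymm_surjective x hu)
    (by
      filter_upwards [eventually_mem_source hu hy'] with w hw a b
      exact metricL_transition hw.1 hw.2 a b) a b
  rwa [fderiv_transition_self hu hy, hψ] at h

lemma tangent_transition (e e' : TangentBundle I M) {z : E × E}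
    (hu : z.1 ∈ (extChartAt I e.proj).target)
    (hy : (extChartAt I e.proj).symm z.1 ∈ (extChartAt I e'.proj).source) :
    extChartAt I.tangent e' ((extChartAt I.tangent e).symm z) =
      (transition I e.proj e'.proj z.1, fderiv ℝ (transition I e.proj e'.proj) z.1 z.2) := by
  rw [show z = (z.1, z.2) from rfl, extChartAt_tangent_symm_apply e z.2 hu,
    extChartAt_tangent_apply _ _ hy, fderiv_transition hu hy]
  rfl

end ChartTransition

section CheegerGromollInCharts

variable {E : Type*} [NormedAddCommGroup E] [NormedSpace ℝ E]
  {H : Type*} [TopologicalSpace H] {I : ModelWithCorners ℝ E H} [I.Boundaryless]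
  {M : Type*} [TopologicalSpace M] [ChartedSpace H M] [IsManifold I ∞ M]
  {metric : ContMDiffRiemannianMetric I ∞ E (fun x : M ↦ TangentSpace I x)}

/-- The derivative of the inverse of the chart of the tangent bundle at `e`. -/
noncomputable def dSymmTangent (e : TangentBundle I M) (z : E × E) : E × E →L[ℝ] E × E :=
  mfderiv 𝓘(ℝ, E × E) I.tangent (extChartAt I.tangent e).symm z

variable {e : TangentBundle I M} {z : E × E}

lemma proj_symm (hz : z.1 ∈ (extChartAt I e.proj).target) :
    ((extChartAt I.tangent e).symm z).proj = (extChartAt I e.proj).symm z.1 :=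
  congrArg TotalSpace.proj (extChartAt_tangent_symm_apply e z.2 hz)

lemma snd_symm (hz : z.1 ∈ (extChartAt I e.proj).target) :
    ((extChartAt I.tangent e).symm z).snd = (dSymm I e.proj z.1 z.2 : E) :=
  congrArg (fun e : TangentBundle I M ↦ (e.snd : E)) (extChartAt_tangent_symm_apply e z.2 hz)

lemma dSymmTangent_apply (hz : z.1 ∈ (extChartAt I e.proj).target) (A : E × E) :
    dSymmTangent e z A = (dSymm I e.proj z.1 A.1,
      fderiv ℝ (fderiv ℝ (transition I e.proj ((extChartAt I.tangent e).symm z).proj)) z.1 A.1 z.2 +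
        dSymm I e.proj z.1 A.2) := by
  set e' := (extChartAt I.tangent e).symm z with he'
  have hz' : z ∈ (extChartAt I.tangent e).target := (mem_extChartAt_tangent_target e z.1 z.2).2 hz
  have hy : (extChartAt I e.proj).symm z.1 = e'.proj := (proj_symm hz).symm
  have hy' : (extChartAt I e.proj).symm z.1 ∈ (extChartAt I e'.proj).source := by
    rw [hy]; exact mem_extChartAt_source e'.proj
  set ψ := transition I e.proj e'.proj with hψ
  have h1 := (mdifferentiableAt_extChartAt_symm hz').hasMFDerivAt
  have h2 := (mdifferentiableAt_extChartAt (I := I.tangent) (x := e') (y := e')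
    (mem_chart_source _ _)).hasMFDerivAt
  rw [mfderiv_extChartAt_self] at h2
  have h3 : HasFDerivAt (extChartAt I.tangent e' ∘ (extChartAt I.tangent e).symm)
      (dSymmTangent e z) z := (h2.comp z h1).hasFDerivAt
  have h4 : extChartAt I.tangent e' ∘ (extChartAt I.tangent e).symm =ᶠ[nhds z]
      fun w ↦ (ψ w.1, fderiv ℝ ψ w.1 w.2) := by
    filter_upwards [continuous_fst.continuousAt.eventually (eventually_mem_source hz hy')] with w hw
    exact tangent_transition e e' hw.1 hw.2
  have hc := contDiffAt_transition hz hy'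
  have h5 : HasFDerivAt ψ (fderiv ℝ ψ z.1) z.1 := (hc.differentiableAt (by simp)).hasFDerivAt
  have h6 : HasFDerivAt (fderiv ℝ ψ) (fderiv ℝ (fderiv ℝ ψ) z.1) z.1 :=
    ((hc.fderiv_right (m := ∞) (by simp)).differentiableAt (by simp)).hasFDerivAt
  have hfst : HasFDerivAt (fun w : E × E ↦ w.1) (ContinuousLinearMap.fst ℝ E E) z := hasFDerivAt_fst
  have h7 := (h5.comp z hfst).prodMk ((h6.comp z hfst).clm_apply
    (hasFDerivAt_snd (𝕜 := ℝ) (E := E) (F := E)))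
  have h8 := congrArg (fun f : E × E →L[ℝ] E × E ↦ f A)
    (h3.unique (h7.congr_of_eventuallyEq h4))
  refine Eq.trans h8 ?_
  rw [← fderiv_transition_self hz hy]
  refine Prod.ext ?_ ?_
  · rfl
  · simp [add_comm, hψ]

lemma mfderiv_proj_dSymmTangent (hz : z.1 ∈ (extChartAt I e.proj).target) (A : E × E) :
    (mfderiv I.tangent I (TotalSpace.proj : TangentBundle I M → M)
      ((extChartAt I.tangent e).symm z) (dSymmTangent e z A) : E) = dSymm I e.proj z.1 A.1 := by
  have hz' : z ∈ (extChartAt I.tangent e).target := (mem_extChartAt_tangent_target e z.1 z.2).2 hz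
  have h1 := (mdifferentiableAt_extChartAt_symm hz').hasMFDerivAt
  have h2 : HasMFDerivAt I.tangent I (TotalSpace.proj : TangentBundle I M → M)
      ((extChartAt I.tangent e).symm z) _ :=
    ((contMDiff_proj (IB := I) (n := 1) (TangentSpace I : M → Type _)).mdifferentiableAt
      (by simp)).hasMFDerivAt
  have hfst : HasFDerivAt (fun w : E × E ↦ w.1) (ContinuousLinearMap.fst ℝ E E) z := hasFDerivAt_fst
  have h3 := (mdifferentiableAt_extChartAt_symm hz).hasMFDerivAt.comp z hfst.hasMFDerivAt
  have h4 : (TotalSpace.proj : TangentBundle I M → M) ∘ (extChartAt I.tangent e).symm =ᶠ[nhds z]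
      (extChartAt I e.proj).symm ∘ fun w ↦ w.1 := by
    filter_upwards [continuous_fst.continuousAt.preimage_mem_nhds
      ((isOpen_extChartAt_target e.proj).mem_nhds hz)] with w hw
    exact proj_symm hw
  have h5 := ((h2.comp z h1).congr_of_eventuallyEq h4.symm).mfderiv.symm.trans h3.mfderiv
  exact congrArg (fun f : E × E →L[ℝ] E ↦ f A) h5

variable [FiniteDimensional ℝ E]

lemma connectionMap_dSymmTangent (hz : z.1 ∈ (extChartAt I e.proj).target) (A : E × E) :
    (connectionMap (toFormField metric) ((extChartAt I.tangent e).symm z)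
      (dSymmTangent e z A) : E) = dSymm I e.proj z.1 (vert (metricL metric e.proj) z A) := by
  have h1 : (connectionMap (toFormField metric) ((extChartAt I.tangent e).symm z)
      (dSymmTangent e z A) : E) = (dSymmTangent e z A).2 +
      christoffel (E := E)
        (metricInChart (toFormField metric) ((extChartAt I.tangent e).symm z).proj)
        (extChartAt I _ ((extChartAt I.tangent e).symm z).proj) (dSymmTangent e z A).1
        ((extChartAt I.tangent e).symm z).snd := rfl
  rw [h1, dSymmTangent_apply hz, snd_symm hz, metricInChart_toFormField,
    (isMetricOn_metricL _).christoffel_eq (mem_extChartAt_target _), vert_apply, map_add,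
    ← christoffelL_transition hz (proj_symm hz).symm]
  dsimp only
  abel

/-- The generalised Cheeger-Gromoll metric in the charts of the tangent bundle. -/
lemma metricInChart_genCheegerGromoll {p q : ℝ} (hz : z.1 ∈ (extChartAt I e.proj).target) :
    metricInChart (genCheegerGromoll (toFormField metric) p q) e z =
      fun A B ↦ cheegerL (metricL metric e.proj) p q z A B := by
  have hω : omega (toFormField metric) ((extChartAt I.tangent e).symm z).snd =
      (1 + metricL metric e.proj z.1 z.2 z.2)⁻¹ := by
    have : normSq (toFormField metric) ((extChartAt I.tangent e).symm z).snd =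
        innerL metric ((extChartAt I.tangent e).symm z).proj
          ((extChartAt I.tangent e).symm z).snd ((extChartAt I.tangent e).symm z).snd := rfl
    rw [omega, this, snd_symm hz, proj_symm hz, metricL_apply]
  ext A B
  have h1 : metricInChart (genCheegerGromoll (toFormField metric) p q) e z A B =
      innerL metric ((extChartAt I.tangent e).symm z).proj
        (mfderiv I.tangent I (TotalSpace.proj : TangentBundle I M → M)
          ((extChartAt I.tangent e).symm z) (dSymmTangent e z A))
        (mfderiv I.tangent I (TotalSpace.proj : TangentBundle I M → M)
          ((extChartAt I.tangent e).symm z) (dSymmTangent e z B)) +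
      omega (toFormField metric) ((extChartAt I.tangent e).symm z).snd ^ p *
        (innerL metric ((extChartAt I.tangent e).symm z).proj
          (connectionMap (toFormField metric) ((extChartAt I.tangent e).symm z)
            (dSymmTangent e z A))
          (connectionMap (toFormField metric) ((extChartAt I.tangent e).symm z)
            (dSymmTangent e z B)) +
        q * innerL metric ((extChartAt I.tangent e).symm z).proj
          (connectionMap (toFormField metric) ((extChartAt I.tangent e).symm z)
            (dSymmTangent e z A)) ((extChartAt I.tangent e).symm z).snd *
          innerL metric ((extChartAt I.tangent e).symm z).proj
            (connectionMap (toFormField metric) ((extChartAt I.tangent e).symm z)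
              (dSymmTangent e z B)) ((extChartAt I.tangent e).symm z).snd) := rfl
  rw [h1, hω, cheegerL_apply, mfderiv_proj_dSymmTangent hz, mfderiv_proj_dSymmTangent hz,
    connectionMap_dSymmTangent hz, connectionMap_dSymmTangent hz, snd_symm hz, proj_symm hz]
  rfl

end CheegerGromollInCharts

section VectorFieldInCharts

variable {E : Type*} [NormedAddCommGroup E] [NormedSpace ℝ E]
  {H : Type*} [TopologicalSpace H] {I : ModelWithCorners ℝ E H} [I.Boundaryless]
  {M : Type*} [TopologicalSpace M] [ChartedSpace H M] [IsManifold I ∞ M]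
  {metric : ContMDiffRiemannianMetric I ∞ E (fun x : M ↦ TangentSpace I x)}
  {σ : ∀ x : M, TangentSpace I x}

omit [I.Boundaryless] in
lemma fieldInChart_self (x : M) : fieldInChart σ x (extChartAt I x x) = (σ x : E) := by
  have h (y : M) (hy : y = x) : (mfderiv I 𝓘(ℝ, E) (extChartAt I x) y (σ y) : E) = σ x := by
    subst hy
    rw [mfderiv_extChartAt_self]
    rfl
  exact h _ (extChartAt_to_inv x)

lemma dSymm_fieldInChart (x : M) {u : E} (hu : u ∈ (extChartAt I x).target) :
    dSymm I x u (fieldInChart σ x u) = (σ ((extChartAt I x).symm u) : E) := by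
  have h := mfderivWithin_extChartAt_symm_comp_mfderiv_extChartAt hu
  rw [I.range_eq_univ, mfderivWithin_univ] at h
  exact congrArg (fun f : E →L[ℝ] E ↦ f (σ ((extChartAt I x).symm u))) h

lemma writtenInExtChartAt_section (x : M) :
    writtenInExtChartAt I I.tangent x (fun y ↦ (⟨y, σ y⟩ : TangentBundle I M))
      =ᶠ[nhds (extChartAt I x x)] fun w ↦ (w, fieldInChart σ x w) := by
  filter_upwards [extChartAt_target_mem_nhds x] with w hw
  have h := extChartAt_tangent_apply (I := I) (⟨x, σ x⟩ : TangentBundle I M)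
    ⟨(extChartAt I x).symm w, σ ((extChartAt I x).symm w)⟩ ((extChartAt I x).map_target hw)
  refine Eq.trans h ?_
  rw [(extChartAt I x).right_inv hw]
  rfl

lemma contDiffAt_fieldInChart
    (hσ : ContMDiff I I.tangent ∞ (fun x ↦ (⟨x, σ x⟩ : TangentBundle I M))) (x : M) :
    ContDiffAt ℝ ∞ (fieldInChart σ x) (extChartAt I x x) := by
  have h := (contMDiffAt_iff.1 (hσ x)).2
  rw [I.range_eq_univ, contDiffWithinAt_univ] at h
  have h' := h.congr_of_eventuallyEq (writtenInExtChartAt_section x).symm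
  exact contDiffAt_snd.comp (extChartAt I x x) h'

omit [I.Boundaryless] in
lemma extChartAt_tangent_self (x : M) :
    extChartAt I.tangent (⟨x, σ x⟩ : TangentBundle I M) ⟨x, σ x⟩ =
      (extChartAt I x x, fieldInChart σ x (extChartAt I x x)) := by
  rw [extChartAt_tangent_apply _ _ (mem_extChartAt_source _), mfderiv_extChartAt_self,
    fieldInChart_self]
  rfl

lemma mfderiv_half_normSq [FiniteDimensional ℝ E]
    (hσ : ContMDiff I I.tangent ∞ (fun x ↦ (⟨x, σ x⟩ : TangentBundle I M))) (x : M) :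
    (mfderiv I 𝓘(ℝ, ℝ) (fun y ↦ normSq (toFormField metric) (σ y) / 2) x : E →L[ℝ] ℝ) =
      fderiv ℝ (fun w ↦ metricL metric x w (fieldInChart σ x w) (fieldInChart σ x w) / 2)
        (extChartAt I x x) := by
  set F : E → ℝ :=
    fun w ↦ metricL metric x w (fieldInChart σ x w) (fieldInChart σ x w) / 2 with hF
  have hs := (contDiffAt_fieldInChart hσ x).differentiableAt (by simp)
  have h0 : DifferentiableAt ℝ (fun w ↦ metricL metric x w (fieldInChart σ x w)
      (fieldInChart σ x w)) (extChartAt I x x) :=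
    (((isMetricOn_metricL x).differentiableAt (mem_extChartAt_target x)).clm_apply hs).clm_apply hs
  have h1 : HasFDerivAt F (fderiv ℝ F (extChartAt I x x)) (extChartAt I x x) := by
    have : DifferentiableAt ℝ F (extChartAt I x x) := by
      simpa only [hF, div_eq_mul_inv] using h0.mul_const (2 : ℝ)⁻¹
    exact this.hasFDerivAt
  have h2 := (mdifferentiableAt_extChartAt (I := I) (mem_chart_source H x)).hasMFDerivAt
  rw [mfderiv_extChartAt_self] at h2
  have h3 : (fun y ↦ normSq (toFormField metric) (σ y) / 2) =ᶠ[nhds x] F ∘ extChartAt I x := by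
    filter_upwards [extChartAt_source_mem_nhds (I := I) x] with y hy
    have hy' := (extChartAt I x).map_source hy
    change _ = metricL metric x _ _ _ / 2
    rw [metricL_apply, dSymm_fieldInChart x hy', (extChartAt I x).left_inv hy]
    rfl
  exact ((h1.hasMFDerivAt.comp x h2).congr_of_eventuallyEq h3).mfderiv

/-- A vector field is a harmonic map at a point if and only if both equations hold there. -/
theorem tensionField_eq_zero_iff [FiniteDimensional ℝ E] {p q : ℝ} (hq : 0 ≤ q)
    (hσ : ContMDiff I I.tangent ∞ (fun x ↦ (⟨x, σ x⟩ : TangentBundle I M))) (x : M)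
    {ι : Type*} [Fintype ι] [DecidableEq ι] (e : Module.Basis ι ℝ (TangentSpace I x))
    (he : ∀ i j, toFormField metric x (e i) (e j) = if i = j then 1 else 0) :
    tensionField (toFormField metric) (genCheegerGromoll (toFormField metric) p q)
        (fun x ↦ (⟨x, σ x⟩ : TangentBundle I M)) x = 0 ↔
      ∑ i, curvature (toFormField metric) x (σ x)
        (covDeriv (toFormField metric) σ x (e i)) (e i) = 0 ∧
      roughLaplacian (toFormField metric) σ x +
          (2 * p * omega (toFormField metric) (σ x)) • covDeriv (toFormField metric) σ x
            (gradHalfNormSq (toFormField metric) σ x) =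
        ((p * omega (toFormField metric) (σ x) + q) /
            (1 + q * normSq (toFormField metric) (σ x)) *
              covDerivNormSq (toFormField metric) σ x +
          p * q * omega (toFormField metric) (σ x) /
            (1 + q * normSq (toFormField metric) (σ x)) *
              normSq (toFormField metric) (gradHalfNormSq (toFormField metric) σ x)) • σ x := by
  set u : E := extChartAt I x x with hu
  set s : E → E := fieldInChart σ x with hs
  have hsu : s u = (σ x : E) := fieldInChart_self x
  have hut : u ∈ (extChartAt I x).target := mem_extChartAt_target x
  have hself : metricL metric x u = innerL metric x := metricL_self x
  have hH : metricInChart (genCheegerGromoll (toFormField metric) p q)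
      (⟨x, σ x⟩ : TangentBundle I M) =ᶠ[nhds (u, s u)]
      fun z A B ↦ cheegerL (metricL metric x) p q z A B := by
    filter_upwards [continuous_fst.continuousAt.preimage_mem_nhds
      ((isOpen_extChartAt_target x).mem_nhds hut)] with z hz
    exact metricInChart_genCheegerGromoll (e := (⟨x, σ x⟩ : TangentBundle I M)) hz
  have key := local_tension_eq_zero_iff (isMetricOn_metricL (metric := metric) x) hq hut
    (contDiffAt_fieldInChart hσ x) (writtenInExtChartAt_section x) hH (ι := ι)
    (show Module.Basis ι ℝ E from e) (by rw [hself]; exact he)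
  rw [← hs, hself, ← mfderiv_half_normSq hσ x, hsu] at key
  have h1 : tensionField (toFormField metric) (genCheegerGromoll (toFormField metric) p q)
        (fun x ↦ (⟨x, σ x⟩ : TangentBundle I M)) x = metricTrace (fun a b ↦ innerL metric x a b)
      (fun a b ↦ fderiv ℝ (fun w ↦ fderiv ℝ (writtenInExtChartAt I I.tangent x
        (fun y ↦ (⟨y, σ y⟩ : TangentBundle I M))) w b) u a
          - fderiv ℝ (writtenInExtChartAt I I.tangent x
        (fun y ↦ (⟨y, σ y⟩ : TangentBundle I M))) u
            (christoffel (fun w a b ↦ metricL metric x w a b) u a b)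
          + christoffel (metricInChart (genCheegerGromoll (toFormField metric) p q)
      (⟨x, σ x⟩ : TangentBundle I M)) (extChartAt I.tangent (⟨x, σ x⟩ : TangentBundle I M)
        ⟨x, σ x⟩) (fderiv ℝ (writtenInExtChartAt I I.tangent x
        (fun y ↦ (⟨y, σ y⟩ : TangentBundle I M))) u a) (fderiv ℝ (writtenInExtChartAt I I.tangent x
        (fun y ↦ (⟨y, σ y⟩ : TangentBundle I M))) u b)) := rfl
  rw [h1, extChartAt_tangent_self, ← hu, ← hs, hsu]
  exact key

end VectorFieldInCharts

end GenCheegerGromoll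

open GenCheegerGromoll
theorem mainTheorem4
    {E : Type*} [NormedAddCommGroup E] [NormedSpace ℝ E] [FiniteDimensional ℝ E]
    {H : Type*} [TopologicalSpace H] {I : ModelWithCorners ℝ E H} [I.Boundaryless]
    {M : Type*} [TopologicalSpace M] [ChartedSpace H M] [IsManifold I ∞ M]
    (metric : ContMDiffRiemannianMetric I ∞ E (fun x : M ↦ TangentSpace I x))
    (g : FormField I M) (hg : g = toFormField metric)
    (p q : ℝ) (hq : 0 ≤ q)
    (σ : ∀ x : M, TangentSpace I x)
    (hσ : ContMDiff I I.tangent ∞ (fun x ↦ (⟨x, σ x⟩ : TangentBundle I M)))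
    {ι : Type*} [Fintype ι] [DecidableEq ι]
    (e : ∀ x : M, Module.Basis ι ℝ (TangentSpace I x))
    (he : ∀ x i j, g x (e x i) (e x j) = if i = j then 1 else 0) :
    IsHarmonicMap g (genCheegerGromoll g p q) (fun x ↦ (⟨x, σ x⟩ : TangentBundle I M)) ↔
      (∀ x, ∑ i, curvature g x (σ x) (covDeriv g σ x (e x i)) (e x i) = 0) ∧
      (∀ x, roughLaplacian g σ x +
          (2 * p * omega g (σ x)) • covDeriv g σ x (gradHalfNormSq g σ x) =
        ((p * omega g (σ x) + q) / (1 + q * normSq g (σ x)) * covDerivNormSq g σ x +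
          p * q * omega g (σ x) / (1 + q * normSq g (σ x)) *
            normSq g (gradHalfNormSq g σ x)) • σ x) := by
  subst hg
  rw [← forall_and]
  refine ⟨fun h x ↦ ?_, fun h ↦ ⟨hσ, fun x ↦ ?_⟩⟩
  · exact (tensionField_eq_zero_iff hq hσ x (e x) (he x)).1 (h.2 x)
  · exact (tensionField_eq_zero_iff hq hσ x (e x) (he x)).2 (h x)
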